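/- Let $n\ge 1$ and let $S_1,\dots,S_n$ be codimension-1 embedded submanifolds of $\mathbb R^n$ that are smooth ($C^1$ suffices), with surface measures $d\sigma_1,\dots,d\sigma_n$. For $\xi_j\in S_j$ let $v_j(\xi_j)$ be a unit normal to $S_j$ at $\xi_j$. Suppose that $$v_1(\xi_1)\wedge\cdots\wedge v_n(\xi_n)\neq 0\qquad\text{for all }\xi_1\in S_1,\dots,\xi_n\in S_n,$$ and that the following global transversality condition holds: if $\xi_j,\eta_j\in S_j$ $(1\le j\le n)$ and $\xi_1-\eta_1=\xi_2-\eta_2=\cdots=\xi_n-\eta_n$, then this common difference is $0$. Let $g_j\in L^1(S_j,d\sigma_j)$ be complex-valued and put $$\widehat{g_jd\sigma_j}(x)=\int_{S_j}g_j(\xi)e^{-2\pi i x\cdot\xi}\,d\sigma_j(\xi)\qquad(x\in\mathbb R^n).$$ Then the convolution $|\widehat{g_1d\sigma_1}|^2*\cdots*|\widehat{g_nd\sigma_n}|^2$ (for $n=1$, just $|\widehat{g_1d\sigma_1}|^2$) is constant: for every $x\in\mathbb R^n$, $$\bigl(|\widehat{g_1d\sigma_1}|^2*\cdots*|\widehat{g_nd\sigma_n}|^2\bigr)(x)=\int_{S_1\times\cdots\times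 S_n}\frac{|g_1(\xi_1)|^2\cdots|g_n(\xi_n)|^2}{|v_1(\xi_1)\wedge\cdots\wedge v_n(\xi_n)|}\,d\sigma_1(\xi_1)\cdots d\sigma_n(\xi_n),$$ as an identity between elements of $[0,\infty]$. Here $|w_1\wedge\cdots\wedge w_n|=|\det(w_1,\dots,w_n)|$. -/

import Mathlib

open MeasureTheory
open scoped ENNReal

/-- `S ⊆ ℝⁿ` is an (embedded) `C¹` submanifold of codimension one: near each of its points it is
the zero set of a `C¹` function without critical points. -/
def IsC1Hypersurface {n : ℕ} (S : Set (EuclideanSpace ℝ (Fin n))) : Prop :=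
  ∀ p ∈ S, ∃ U : Set (EuclideanSpace ℝ (Fin n)), IsOpen U ∧ p ∈ U ∧
    ∃ f : EuclideanSpace ℝ (Fin n) → ℝ, ContDiffOn ℝ 1 f U ∧
      (∀ x ∈ U, fderiv ℝ f x ≠ 0) ∧ S ∩ U = {x ∈ U | f x = 0}

/-- `w` is a unit normal to `S` at `ξ`: a unit vector orthogonal to the tangent space of `S`
at `ξ` (for a point of a `C¹` hypersurface, the tangent cone is the tangent hyperplane). -/
def IsUnitNormalAt {n : ℕ} (S : Set (EuclideanSpace ℝ (Fin n)))
    (ξ w : EuclideanSpace ℝ (Fin n)) : Prop :=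
  ‖w‖ = 1 ∧ ∀ t ∈ tangentConeAt ℝ S ξ, inner ℝ w t = 0

/-- Surface measure on a hypersurface `S` of `ℝ^(m+1)`: the `m`-dimensional Hausdorff measure,
normalised to agree with Lebesgue measure on `ℝ^m`, restricted to `S`. -/
noncomputable def surfaceMeasure {m : ℕ} (S : Set (EuclideanSpace ℝ (Fin (m + 1)))) :
    Measure (EuclideanSpace ℝ (Fin (m + 1))) :=
  (Measure.euclideanHausdorffMeasure m).restrict S

/-- The Fourier extension operator `x ↦ ∫ g(ξ) exp(-2πi x·ξ) dσ(ξ)`. -/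
noncomputable def fourierExtension {n : ℕ} (σ : Measure (EuclideanSpace ℝ (Fin n)))
    (g : EuclideanSpace ℝ (Fin n) → ℂ) (x : EuclideanSpace ℝ (Fin n)) : ℂ :=
  ∫ ξ, g ξ * Complex.exp (-2 * Real.pi * Complex.I * (inner ℝ x ξ : ℝ)) ∂σ

/-- `|w₁ ∧ ⋯ ∧ wₙ|` for `n` vectors of `ℝⁿ`: the absolute value of their determinant. -/
noncomputable def wedgeAbs {n : ℕ} (w : Fin n → EuclideanSpace ℝ (Fin n)) : ℝ :=
  |Matrix.det (Matrix.of fun i j : Fin n => w i j)|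

/-- The iterated convolution `f₀ ∗ f₁ ∗ ⋯ ∗ f_k` (with respect to Lebesgue measure) of
`[0, ∞]`-valued functions. -/
noncomputable def iteratedLConv {n : ℕ} :
    (k : ℕ) → (Fin (k + 1) → EuclideanSpace ℝ (Fin n) → ℝ≥0∞) →
      EuclideanSpace ℝ (Fin n) → ℝ≥0∞
  | 0, f => f 0
  | k + 1, f => lconvolution (f 0) (iteratedLConv k fun j => f j.succ) volume

/-!
The convolution at `x` is an integral over frequencies `y₀, …, y_m` with sum `x` of the squared
modulus of the product of the extensions of the `g_j`. On this affine subspace that product is the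
Fourier transform, in the free variables `y₀, …, y_(m-1)`, of the image of the measure
`G dσ₀ ⋯ dσ_m`, where `G(ξ) = exp(-2πi x·ξ_m) ∏ g_j(ξ_j)`, under the difference map
`subLast : ξ ↦ (ξ₀ - ξ_m, …, ξ_(m-1) - ξ_m)`
(`iteratedLConv_eq_lintegral_pi`, `prod_fourierExtension_eq_integral`).

The product of the hypersurfaces and the target of `subLast` have the same dimension `m (m + 1)`.
Global transversality makes `subLast` injective on the product, and its Jacobian `J` is
`|v₀ ∧ ⋯ ∧ v_m|` (`map_subLast_withDensity_wedgeAbs`). Hence the image measure has density `G / J`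
in the coordinates `w = subLast ξ` (`exists_density_of_map_withDensity`). Plancherel's identity,
valid in `[0, ∞]` for every integrable function (`lintegral_enorm_sq_fourier`), turns the
convolution into `∫ |G|² / J² dw = ∫ |G|² / J dσ`, and the unimodular factor of `G`, which contains
`x`, has disappeared.

The change of variables is obtained without parametrising the hypersurfaces by smooth maps. Near a
point, `S_j` is almost flat (`IsC1Hypersurface.exists_flat_nhd`): its orthogonal projection to the
tangent hyperplane is almost isometric, so that the Hausdorff measure on `S_j` is comparable to
Lebesgue measure on the hyperplane with constants close to one (`exists_flat_chart`). In these
charts `subLast` is a small perturbation of the difference map on the product of the tangent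
hyperplanes, whose determinant is computed in `measurePreserving_subLast_hyperplanes`. Two measures
which agree locally up to factors arbitrarily close to one are equal
(`Measure.le_of_forall_nhd_le_mul`).
-/

/-! ### Plancherel's identity for integrable functions -/

section Plancherel

open scoped FourierTransform SchwartzMap ContDiff

variable {V : Type*} [NormedAddCommGroup V] [InnerProductSpace ℝ V] [FiniteDimensional ℝ V]
  [MeasurableSpace V] [BorelSpace V]

/-- Locally integrable functions are determined by their integrals against Schwartz functions. -/
theorem ae_eq_of_forall_integral_schwartz_mul_eq {f₁ f₂ : V → ℂ} (h₁ : LocallyIntegrable f₁)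
    (h₂ : LocallyIntegrable f₂)
    (h : ∀ φ : 𝓢(V, ℂ), ∫ x, φ x * f₁ x = ∫ x, φ x * f₂ x) : f₁ =ᵐ[volume] f₂ := by
  refine ae_eq_of_integral_contDiff_smul_eq h₁ h₂ fun φ hφ hφc => ?_
  have hc : HasCompactSupport (Complex.ofRealCLM ∘ φ) := hφc.comp_left rfl
  have hs : ContDiff ℝ ∞ (Complex.ofRealCLM ∘ φ) := by fun_prop
  simpa [Complex.real_smul] using h (hc.toSchwartzMap hs)

theorem integral_schwartz_mul_fourier_eq {f : V → ℂ} (hf : Integrable f) (φ : 𝓢(V, ℂ)) :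
    ∫ x, φ x * 𝓕 f x = ∫ x, 𝓕 φ x * f x := by
  have := VectorFourier.integral_fourierIntegral_smul_eq_flip (L := innerₗ V)
    Real.continuous_fourierChar continuous_inner (φ.integrable (μ := volume)) hf
  simp only [smul_eq_mul, flip_innerₗ] at this
  exact this.symm

theorem continuous_fourier_of_integrable {f : V → ℂ} (hf : Integrable f) : Continuous (𝓕 f) :=
  VectorFourier.fourierIntegral_continuous Real.continuous_fourierChar
    (innerSL ℝ).continuous₂ hf

/-- On `L¹ ∩ L²` the Fourier integral represents the `L²` Fourier transform. -/
theorem fourier_toLp_ae_eq {f : V → ℂ} (hf : Integrable f) (hf2 : MemLp f 2) :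
    ((𝓕 (hf2.toLp f) : Lp (α := V) ℂ 2) : V → ℂ) =ᵐ[volume] 𝓕 f := by
  refine ae_eq_of_forall_integral_schwartz_mul_eq
    ((Lp.memLp _).locallyIntegrable (by norm_num))
    (continuous_fourier_of_integrable hf).locallyIntegrable fun φ => ?_
  have h := congrArg (fun T => T φ) (Lp.fourier_toTemperedDistribution_eq (hf2.toLp f))
  simp only [TemperedDistribution.fourier_apply, Lp.toTemperedDistribution_apply,
    smul_eq_mul] at h
  rw [← h, integral_schwartz_mul_fourier_eq hf]
  refine integral_congr_ae ?_
  filter_upwards [hf2.coeFn_toLp] with x hx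
  rw [hx, SchwartzMap.fourier_coe]

/-- An integrable function with square-integrable Fourier integral is square-integrable: it is the
`L²` inverse transform of its Fourier integral. -/
theorem memLp_two_of_memLp_two_fourier {f : V → ℂ} (hf : Integrable f) (hf2 : MemLp (𝓕 f) 2) :
    MemLp f 2 := by
  let K : Lp (α := V) ℂ 2 := 𝓕⁻ (hf2.toLp (𝓕 f))
  refine (memLp_congr_ae ?_).1 (Lp.memLp K)
  refine ae_eq_of_forall_integral_schwartz_mul_eq
    ((Lp.memLp _).locallyIntegrable (by norm_num)) hf.locallyIntegrable fun φ => ?_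
  have h := congrArg (fun T => T φ) (Lp.fourierInv_toTemperedDistribution_eq (hf2.toLp (𝓕 f)))
  simp only [TemperedDistribution.fourierInv_apply, Lp.toTemperedDistribution_apply,
    smul_eq_mul] at h
  rw [← h]
  have h2 := integral_schwartz_mul_fourier_eq hf (𝓕⁻ φ)
  rw [FourierTransform.fourier_fourierInv_eq] at h2
  rw [← h2]
  refine integral_congr_ae ?_
  filter_upwards [hf2.coeFn_toLp] with x hx
  rw [hx]

theorem lintegral_enorm_sq_eq_eLpNorm_sq (f : V → ℂ) :
    ∫⁻ x, ‖f x‖ₑ ^ 2 = eLpNorm f 2 volume ^ 2 := by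
  rw [eLpNorm_eq_lintegral_rpow_enorm_toReal (by norm_num) (by norm_num), ← ENNReal.rpow_natCast,
    ← ENNReal.rpow_mul]
  simp

/-- Plancherel's identity in `[0, ∞]` for every integrable function; square-integrability is not
assumed. -/
theorem lintegral_enorm_sq_fourier {f : V → ℂ} (hf : Integrable f) :
    ∫⁻ y, ‖𝓕 f y‖ₑ ^ 2 = ∫⁻ x, ‖f x‖ₑ ^ 2 := by
  rw [lintegral_enorm_sq_eq_eLpNorm_sq, lintegral_enorm_sq_eq_eLpNorm_sq]
  by_cases hf2 : MemLp f 2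
  · rw [← eLpNorm_congr_ae (fourier_toLp_ae_eq hf hf2), ← eLpNorm_congr_ae hf2.coeFn_toLp,
      ← ENNReal.ofReal_toReal (Lp.memLp (𝓕 (hf2.toLp f))).eLpNorm_ne_top,
      ← ENNReal.ofReal_toReal (Lp.memLp (hf2.toLp f)).eLpNorm_ne_top,
      ← Lp.norm_def, ← Lp.norm_def, Lp.norm_fourier_eq]
  · have h1 : eLpNorm f 2 volume = ⊤ := by
      by_contra h
      exact hf2 ⟨hf.1, lt_top_iff_ne_top.2 h⟩
    have h2 : eLpNorm (𝓕 f) 2 volume = ⊤ := by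
      by_contra h
      exact hf2 (memLp_two_of_memLp_two_fourier hf
        ⟨(continuous_fourier_of_integrable hf).aestronglyMeasurable, lt_top_iff_ne_top.2 h⟩)
    rw [h1, h2]

end Plancherel

section Curry

/-- Currying preserves product measures. -/
theorem measurePreserving_curry_symm {ι κ X : Type*} [Fintype ι] [Fintype κ] [MeasureSpace X]
    [SigmaFinite (volume : Measure X)] :
    MeasurePreserving (MeasurableEquiv.curry ι κ X).symm := by
  refine ⟨(MeasurableEquiv.curry ι κ X).symm.measurable, ?_⟩
  refine (Measure.pi_eq fun s hs => ?_).symm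
  rw [MeasurableEquiv.map_apply]
  have : (MeasurableEquiv.curry ι κ X).symm ⁻¹' Set.univ.pi s =
      Set.univ.pi fun i => Set.univ.pi fun k => s (i, k) := by
    ext w
    simp [Set.mem_pi, MeasurableEquiv.coe_curry_symm, Function.uncurry]
  rw [this, volume_pi_pi]
  simp_rw [volume_pi_pi]
  rw [Fintype.prod_prod_type]

/-- The volume-preserving identification of `ℝ^(κ × ι)` with `(ℝ^ι)^κ`. -/
noncomputable def euclideanCurry (κ ι : Type*) [Fintype ι] [Fintype κ] :
    EuclideanSpace ℝ (κ × ι) ≃ᵐ (κ → EuclideanSpace ℝ ι) :=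
  ((MeasurableEquiv.toLp 2 (κ × ι → ℝ)).symm.trans (MeasurableEquiv.curry κ ι ℝ)).trans
    (MeasurableEquiv.piCongrRight fun _ => MeasurableEquiv.toLp 2 (ι → ℝ))

theorem euclideanCurry_apply {κ ι : Type*} [Fintype ι] [Fintype κ]
    (x : EuclideanSpace ℝ (κ × ι)) (k : κ) (i : ι) : euclideanCurry κ ι x k i = x (k, i) := rfl

theorem measurePreserving_euclideanCurry (κ ι : Type*) [Fintype ι] [Fintype κ] :
    MeasurePreserving (euclideanCurry κ ι) :=
  ((PiLp.volume_preserving_ofLp (κ × ι)).trans (measurePreserving_curry_symm.symm _)).trans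
    (volume_preserving_pi fun _ => PiLp.volume_preserving_toLp ι)

theorem inner_eq_sum_inner_euclideanCurry {κ ι : Type*} [Fintype ι] [Fintype κ]
    (x y : EuclideanSpace ℝ (κ × ι)) :
    inner ℝ x y = ∑ k, inner ℝ (euclideanCurry κ ι x k) (euclideanCurry κ ι y k) := by
  simp only [PiLp.inner_apply, euclideanCurry_apply]
  rw [Fintype.sum_prod_type]

open scoped FourierTransform in
/-- Plancherel's identity on a finite power of a Euclidean space. -/
theorem lintegral_enorm_sq_fourier_pi {κ ι : Type*} [Fintype ι] [Fintype κ]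
    {H : (κ → EuclideanSpace ℝ ι) → ℂ} (hH : Integrable H) :
    ∫⁻ y : κ → EuclideanSpace ℝ ι,
      ‖∫ w, H w * Complex.exp (-2 * Real.pi * Complex.I * (∑ k, inner ℝ (y k) (w k) : ℝ))‖ₑ ^ 2 =
    ∫⁻ w, ‖H w‖ₑ ^ 2 := by
  have hT := measurePreserving_euclideanCurry κ ι
  have hemb := (euclideanCurry κ ι).measurableEmbedding
  rw [← hT.lintegral_comp_emb hemb, ← hT.lintegral_comp_emb hemb]
  refine Eq.trans ?_ (lintegral_enorm_sq_fourier ((hT.integrable_comp_emb hemb).2 hH))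
  refine lintegral_congr fun y => ?_
  congr 2
  rw [← hT.integral_comp hemb, Real.fourier_eq']
  refine integral_congr_ae (Filter.Eventually.of_forall fun w => ?_)
  simp only [smul_eq_mul, ← inner_eq_sum_inner_euclideanCurry,
    real_inner_comm w y]
  rw [mul_comm]
  congr 2
  push_cast
  ring

end Curry

/-! ### Normals and local flatness of hypersurfaces -/

section Normal

open Set Filter Topology

/-- The kernel of the derivative of a defining function is tangent to the level set. -/
theorem ker_subset_tangentConeAt {E : Type*} [NormedAddCommGroup E] [NormedSpace ℝ E]
    [FiniteDimensional ℝ E] {f : E → ℝ} {f' : E →L[ℝ] ℝ} {p : E} {S U : Set E}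
    (hf : HasStrictFDerivAt f f' p) (hf' : f' ≠ 0) (hp : f p = 0) (hU : U ∈ 𝓝 p)
    (hS : ∀ x ∈ U, f x = 0 → x ∈ S) {t : E} (ht : f' t = 0) : t ∈ tangentConeAt ℝ S p := by
  have : CompleteSpace E := FiniteDimensional.complete ℝ E
  have hr : (f' : E →ₗ[ℝ] ℝ).range = ⊤ :=
    LinearMap.range_eq_top.2
      (LinearMap.surjective fun h => hf' (ContinuousLinearMap.coe_injective h))
  set φ := hf.implicitFunction f f' hr (f p) with hφ
  have hφd : HasStrictFDerivAt φ f'.ker.subtypeL 0 := hf.to_implicitFunction hr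
  have hφ0 : φ 0 = p := hf.implicitFunction_apply_image hr
  have hz : ∀ᶠ y in 𝓝 (0 : f'.ker), f (φ y) = 0 := by
    have h := (hf.map_implicitFunction_eq hr).curry_nhds.self_of_nhds
    filter_upwards [h] with y hy
    exact hy.trans hp
  have hUy : ∀ᶠ y in 𝓝 (0 : f'.ker), φ y ∈ U :=
    hφd.continuousAt.eventually (by rw [hφ0]; exact hU)
  have hN := hz.and hUy
  have key := (hφd.hasFDerivAt.hasFDerivWithinAt
    (s := {y | f (φ y) = 0 ∧ φ y ∈ U})).mapsTo_tangent_cone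
      (show (⟨t, ht⟩ : f'.ker) ∈ _ by rw [tangentConeAt_of_mem_nhds hN]; trivial)
  rw [hφ0] at key
  refine tangentConeAt_mono ?_ key
  rintro _ ⟨y, hy, rfl⟩
  exact hS _ hy.2 hy.1

variable {n : ℕ}

/-- Where `S` is cut out by a defining function, a unit normal is the normalised gradient up to
sign. -/
theorem IsUnitNormalAt.eq_or_eq_neg {S U : Set (EuclideanSpace ℝ (Fin n))}
    {f : EuclideanSpace ℝ (Fin n) → ℝ} {q w : EuclideanSpace ℝ (Fin n)}
    (hw : IsUnitNormalAt S q w) (hU : IsOpen U) (hf : ContDiffOn ℝ 1 f U)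
    (hf' : fderiv ℝ f q ≠ 0) (hS : S ∩ U = {x ∈ U | f x = 0}) (hqS : q ∈ S) (hqU : q ∈ U) :
    w = ‖gradient f q‖⁻¹ • gradient f q ∨ w = -(‖gradient f q‖⁻¹ • gradient f q) := by
  have hstrict : HasStrictFDerivAt f (fderiv ℝ f q) q :=
    (hf.contDiffAt (hU.mem_nhds hqU)).hasStrictFDerivAt one_ne_zero
  set G := gradient f q with hG
  have hGi : ∀ x, fderiv ℝ f q x = inner ℝ G x := fun x => by
    rw [hG, gradient, InnerProductSpace.toDual_symm_apply]
  have hG0 : G ≠ 0 := by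
    intro h0
    refine hf' (ContinuousLinearMap.ext fun x => ?_)
    rw [hGi, h0]; simp
  have hGn : ‖G‖ ≠ 0 := norm_ne_zero_iff.2 hG0
  have hf0 : f q = 0 := by
    have : q ∈ {x ∈ U | f x = 0} := hS ▸ ⟨hqS, hqU⟩
    exact this.2
  set a : ℝ := inner ℝ G w / ‖G‖ ^ 2 with ha
  have hGt : inner ℝ G (w - a • G) = 0 := by
    rw [inner_sub_right, inner_smul_right, real_inner_self_eq_norm_sq, ha]
    field_simp
    ring
  have ht := hw.2 (w - a • G) (ker_subset_tangentConeAt hstrict hf' hf0 (hU.mem_nhds hqU)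
    (fun x hx h => (hS.symm.subset ⟨hx, h⟩ : x ∈ S ∩ U).1) (by rw [hGi, hGt]))
  have hzero : w - a • G = 0 := by
    rw [← inner_self_eq_zero (𝕜 := ℝ), inner_sub_left, inner_smul_left, ht, hGt]
    simp
  have hwa : w = a • G := sub_eq_zero.1 hzero
  have hn : |a| * ‖G‖ = 1 := by
    rw [← hw.1, hwa, norm_smul, Real.norm_eq_abs]
  have ha' : |a| = ‖G‖⁻¹ := eq_inv_of_mul_eq_one_left hn
  rcases abs_choice a with h | h
  · left; rw [hwa, ← ha', h]
  · right; rw [hwa, ← ha', h, neg_smul, neg_neg]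

/-- Near each of its points, a `C¹` hypersurface carries a unit normal field which is the
restriction of a continuous function on an open set. -/
theorem IsC1Hypersurface.exists_continuousOn_normal {S : Set (EuclideanSpace ℝ (Fin n))}
    (hS : IsC1Hypersurface S) {p : EuclideanSpace ℝ (Fin n)} (hp : p ∈ S) :
    ∃ U : Set (EuclideanSpace ℝ (Fin n)), IsOpen U ∧ p ∈ U ∧
      ∃ N : EuclideanSpace ℝ (Fin n) → EuclideanSpace ℝ (Fin n), ContinuousOn N U ∧
        ∀ q ∈ S ∩ U, ∀ w, IsUnitNormalAt S q w → w = N q ∨ w = -N q := by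
  obtain ⟨U, hU, hpU, f, hf, hf', hSU⟩ := hS p hp
  refine ⟨U, hU, hpU, fun q => ‖gradient f q‖⁻¹ • gradient f q, ?_, fun q hq w hw =>
    hw.eq_or_eq_neg hU hf (hf' q hq.2) hSU hq.1 hq.2⟩
  have hc : ContinuousOn (gradient f) U :=
    (InnerProductSpace.toDual ℝ (EuclideanSpace ℝ (Fin n))).symm.continuous.comp_continuousOn
      (hf.continuousOn_fderiv_of_isOpen hU le_rfl)
  refine (hc.norm.inv₀ fun q hq h => hf' q hq ?_).smul hc
  rw [norm_eq_zero, gradient, LinearIsometryEquiv.map_eq_zero_iff] at h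
  exact h

/-- A `C¹` hypersurface is locally almost flat: near `p`, chords make a small angle with the tangent
hyperplane at `p`. -/
theorem IsC1Hypersurface.exists_flat_nhd {S : Set (EuclideanSpace ℝ (Fin n))}
    (hS : IsC1Hypersurface S) {p w : EuclideanSpace ℝ (Fin n)} (hp : p ∈ S)
    (hw : IsUnitNormalAt S p w) {ε : ℝ} (hε : 0 < ε) :
    ∃ V : Set (EuclideanSpace ℝ (Fin n)), IsOpen V ∧ p ∈ V ∧
      ∀ x ∈ S ∩ V, ∀ y ∈ S ∩ V, |inner ℝ w (x - y)| ≤ ε * ‖x - y‖ := by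
  obtain ⟨U, hU, hpU, f, hf, hf', hSU⟩ := hS p hp
  have hstrict : HasStrictFDerivAt f (fderiv ℝ f p) p :=
    (hf.contDiffAt (hU.mem_nhds hpU)).hasStrictFDerivAt one_ne_zero
  have hGi : ∀ x, fderiv ℝ f p x = inner ℝ (gradient f p) x := fun x => by
    rw [gradient, InnerProductSpace.toDual_symm_apply]
  have hn : 0 < ‖gradient f p‖ := by
    rw [norm_pos_iff, gradient, Ne, LinearIsometryEquiv.map_eq_zero_iff]
    exact hf' p hpU
  have hc : 0 < ε * ‖gradient f p‖ := mul_pos hε hn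
  obtain ⟨s, hs, hfs⟩ := hstrict.approximates_deriv_on_nhds
    (c := ⟨ε * ‖gradient f p‖, hc.le⟩) (Or.inr hc)
  obtain ⟨V, hVs, hV, hpV⟩ := mem_nhds_iff.1 (inter_mem hs (hU.mem_nhds hpU))
  refine ⟨V, hV, hpV, fun x hx y hy => ?_⟩
  have hzero : ∀ z ∈ S ∩ V, f z = 0 := fun z hz =>
    (hSU.subset ⟨hz.1, (hVs hz.2).2⟩).2
  have h := hfs x (hVs hx.2).1 y (hVs hy.2).1
  rw [hzero x hx, hzero y hy, sub_zero, zero_sub, norm_neg, hGi, Real.norm_eq_abs] at h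
  have habs : |inner ℝ w (x - y)| = ‖gradient f p‖⁻¹ * |inner ℝ (gradient f p) (x - y)| := by
    rcases hw.eq_or_eq_neg hU hf (hf' p hpU) hSU hp hpU with h | h
    · rw [h, real_inner_smul_left, abs_mul, abs_inv, abs_norm]
    · rw [h, inner_neg_left, abs_neg, real_inner_smul_left, abs_mul, abs_inv, abs_norm]
  rw [habs]
  calc ‖gradient f p‖⁻¹ * |inner ℝ (gradient f p) (x - y)|
      ≤ ‖gradient f p‖⁻¹ * (ε * ‖gradient f p‖ * ‖x - y‖) := by
        gcongr
        exact h
    _ = ε * ‖x - y‖ := by field_simp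

/-- Lindelöf's property for a local condition on open sets. -/
theorem exists_countable_open_cover {X : Type*} [TopologicalSpace X] [SecondCountableTopology X]
    {s : Set X} {P : Set X → Prop} (h : ∀ x ∈ s, ∃ V, IsOpen V ∧ x ∈ V ∧ P V) :
    ∃ C : Set (Set X), C.Countable ∧ (∀ V ∈ C, IsOpen V ∧ P V) ∧ s ⊆ ⋃₀ C := by
  obtain ⟨C, hC, hCs, hCU⟩ := TopologicalSpace.isOpen_sUnion_countable
    {V : Set X | IsOpen V ∧ P V} fun V hV => hV.1
  refine ⟨C, hC, fun V hV => hCs hV, fun x hx => ?_⟩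
  obtain ⟨V, hV, hxV, hPV⟩ := h x hx
  rw [hCU]
  exact ⟨V, ⟨hV, hPV⟩, hxV⟩

theorem IsC1Hypersurface.measurableSet {S : Set (EuclideanSpace ℝ (Fin n))}
    (hS : IsC1Hypersurface S) : MeasurableSet S := by
  obtain ⟨C, hC, hCV, hSC⟩ := exists_countable_open_cover (s := S)
    (P := fun V => MeasurableSet (S ∩ V)) fun p hp => by
      obtain ⟨U, hU, hpU, f, hf, -, hSU⟩ := hS p hp
      refine ⟨U, hU, hpU, ?_⟩
      have : S ∩ U = U \ (U ∩ f ⁻¹' {0}ᶜ) := by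
        rw [hSU]; ext x; simp
      rw [this]
      exact hU.measurableSet.diff
        (hf.continuousOn.isOpen_inter_preimage hU isOpen_compl_singleton).measurableSet
  have : S = ⋃ V ∈ C, S ∩ V := by
    rw [← inter_iUnion₂, ← sUnion_eq_biUnion, inter_eq_left.2 hSC]
  rw [this]
  exact MeasurableSet.biUnion hC fun V hV => (hCV V hV).2

end Normal

/-! ### Hausdorff measure of almost flat sets -/

section Chart

open Set Filter Topology
open scoped NNReal

/-- Effect of a Lipschitz map on the normalised Hausdorff measure. -/
theorem LipschitzOnWith.euclideanHausdorffMeasure_image_le {X Y : Type*} [MetricSpace X]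
    [MeasurableSpace X] [BorelSpace X] [MetricSpace Y] [MeasurableSpace Y] [BorelSpace Y]
    {K : ℝ≥0} {f : X → Y} {s : Set X} (h : LipschitzOnWith K f s) (d : ℕ) :
    Measure.euclideanHausdorffMeasure d (f '' s) ≤
      (K : ℝ≥0∞) ^ d * Measure.euclideanHausdorffMeasure d s := by
  simp only [Measure.euclideanHausdorffMeasure_def, Measure.smul_apply, ENNReal.smul_def,
    smul_eq_mul]
  have := h.hausdorffMeasure_image_le (d := d) (Nat.cast_nonneg d)
  rw [ENNReal.rpow_natCast] at this
  rw [mul_left_comm]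
  gcongr

variable {m : ℕ}

/-- Orthonormal coordinates on the hyperplane orthogonal to a unit vector: an isometric embedding
`e` of `ℝ^m` and the coordinate map `P` of the orthogonal projection. -/
theorem exists_hyperplane_coordinates {w : EuclideanSpace ℝ (Fin (m + 1))} (hw : ‖w‖ = 1) :
    ∃ (e : EuclideanSpace ℝ (Fin m) →ₗᵢ[ℝ] EuclideanSpace ℝ (Fin (m + 1)))
      (P : EuclideanSpace ℝ (Fin (m + 1)) →L[ℝ] EuclideanSpace ℝ (Fin m)),
      (∀ x, x = e (P x) + (inner ℝ w x : ℝ) • w) ∧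
      (∀ t, inner ℝ w (e t) = (0 : ℝ)) := by
  have hw0 : w ≠ 0 := by
    rintro rfl; simp at hw
  have : Fact (Module.finrank ℝ (EuclideanSpace ℝ (Fin (m + 1))) = m + 1) := ⟨by simp⟩
  let b := OrthonormalBasis.fromOrthogonalSpanSingleton (𝕜 := ℝ) m hw0
  let e := (ℝ ∙ w)ᗮ.subtypeₗᵢ.comp b.repr.symm.toLinearIsometry
  let P := (b.repr : (ℝ ∙ w)ᗮ →L[ℝ] EuclideanSpace ℝ (Fin m)).comp
    ((ℝ ∙ w)ᗮ.orthogonalProjectionOnto)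
  refine ⟨e, P, fun x => ?_, fun t => ?_⟩
  · have h1 : e (P x) = ((ℝ ∙ w)ᗮ.orthogonalProjectionOnto x : EuclideanSpace ℝ (Fin (m + 1))) := by
      simp [e, P]
    have h2 := Submodule.starProjection_unit_singleton ℝ hw x
    rw [h1, ← Submodule.starProjection_apply, Submodule.starProjection_orthogonal_val, h2]
    simp
  · exact Submodule.mem_orthogonal_singleton_iff_inner_right.1 (b.repr.symm t).2

theorem norm_sq_eq_of_hyperplane_coordinates {w : EuclideanSpace ℝ (Fin (m + 1))} (hw : ‖w‖ = 1)
    {e : EuclideanSpace ℝ (Fin m) →ₗᵢ[ℝ] EuclideanSpace ℝ (Fin (m + 1))}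
    {P : EuclideanSpace ℝ (Fin (m + 1)) →L[ℝ] EuclideanSpace ℝ (Fin m)}
    (hdec : ∀ x, x = e (P x) + (inner ℝ w x : ℝ) • w)
    (horth : ∀ t, inner ℝ w (e t) = (0 : ℝ)) (x : EuclideanSpace ℝ (Fin (m + 1))) :
    ‖x‖ ^ 2 = ‖P x‖ ^ 2 + (inner ℝ w x : ℝ) ^ 2 := by
  conv_lhs => rw [hdec x]
  rw [norm_add_sq_real, inner_smul_right, real_inner_comm w, horth, e.norm_map, norm_smul, hw]
  simp

/-- Comparison of the `m`-dimensional Hausdorff measure of an almost flat set `A` in `ℝ^(m+1)` with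
the Lebesgue measure of its projection to the hyperplane `w^⊥`. The set is parametrised by the
inverse `Q` of the projection. -/
theorem exists_flat_chart {w : EuclideanSpace ℝ (Fin (m + 1))} (hw : ‖w‖ = 1)
    {e : EuclideanSpace ℝ (Fin m) →ₗᵢ[ℝ] EuclideanSpace ℝ (Fin (m + 1))}
    {P : EuclideanSpace ℝ (Fin (m + 1)) →L[ℝ] EuclideanSpace ℝ (Fin m)}
    (hdec : ∀ x, x = e (P x) + (inner ℝ w x : ℝ) • w)
    (horth : ∀ t, inner ℝ w (e t) = (0 : ℝ))
    {A : Set (EuclideanSpace ℝ (Fin (m + 1)))} (hA : MeasurableSet A) {ε : ℝ}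
    {K : ℝ≥0} (hK : 1 ≤ K * (1 - ε))
    (hflat : ∀ x ∈ A, ∀ y ∈ A, |inner ℝ w (x - y)| ≤ ε * ‖x - y‖) :
    ∃ (Q : EuclideanSpace ℝ (Fin m) → EuclideanSpace ℝ (Fin (m + 1)))
      (D : Set (EuclideanSpace ℝ (Fin m))), Measurable Q ∧ MeasurableSet D ∧
      MapsTo Q D A ∧ (∀ t ∈ D, P (Q t) = t) ∧ (∀ x ∈ A, P x ∈ D ∧ Q (P x) = x) ∧
      LipschitzOnWith K Q D ∧
      (volume.restrict D).map Q ≤ (Measure.euclideanHausdorffMeasure m).restrict A ∧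
      (Measure.euclideanHausdorffMeasure m).restrict A ≤
        ((K : ℝ≥0) ^ m) • (volume.restrict D).map Q := by
  classical
  have hns := norm_sq_eq_of_hyperplane_coordinates hw hdec horth
  have hP1 : ∀ x, ‖P x‖ ≤ ‖x‖ := fun x => by
    refine le_of_sq_le_sq ?_ (norm_nonneg x)
    rw [hns x]
    nlinarith [sq_nonneg (inner ℝ w x : ℝ)]
  have hPK : ∀ x ∈ A, ∀ y ∈ A, ‖x - y‖ ≤ K * ‖P x - P y‖ := fun x hx y hy => by
    have h1 : ‖x - y‖ ≤ ‖P (x - y)‖ + ε * ‖x - y‖ := by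
      calc ‖x - y‖ = ‖e (P (x - y)) + (inner ℝ w (x - y) : ℝ) • w‖ := by rw [← hdec]
        _ ≤ ‖e (P (x - y))‖ + ‖(inner ℝ w (x - y) : ℝ) • w‖ := norm_add_le _ _
        _ = ‖P (x - y)‖ + |inner ℝ w (x - y)| := by
            rw [e.norm_map, norm_smul, hw, mul_one, Real.norm_eq_abs]
        _ ≤ _ := by gcongr; exact hflat x hx y hy
    rw [map_sub] at h1
    have h2 : (1 - ε) * ‖x - y‖ ≤ ‖P x - P y‖ := by linarith
    have hK0 : (0 : ℝ) ≤ K := K.2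
    calc ‖x - y‖ ≤ (K * (1 - ε)) * ‖x - y‖ := le_mul_of_one_le_left (norm_nonneg _) hK
      _ = K * ((1 - ε) * ‖x - y‖) := by ring
      _ ≤ _ := by gcongr
  have hinj : InjOn P A := fun x hx y hy h => by
    have := hPK x hx y hy
    rw [h, sub_self, norm_zero, mul_zero] at this
    exact sub_eq_zero.1 (norm_le_zero_iff.1 this)
  set D := P '' A with hD
  have hDm : MeasurableSet D := hA.image_of_continuousOn_injOn P.continuous.continuousOn hinj
  set Q : EuclideanSpace ℝ (Fin m) → EuclideanSpace ℝ (Fin (m + 1)) :=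
    D.piecewise (Function.invFunOn P A) 0 with hQ
  have hQD : ∀ t ∈ D, Q t ∈ A ∧ P (Q t) = t := fun t ht => by
    rw [hQ, piecewise_eq_of_mem _ _ _ ht]
    exact ⟨Function.invFunOn_mem ht, Function.invFunOn_eq ht⟩
  have hQP : ∀ x ∈ A, P x ∈ D ∧ Q (P x) = x := fun x hx => by
    have h1 : P x ∈ D := mem_image_of_mem P hx
    exact ⟨h1, hinj (hQD _ h1).1 hx (hQD _ h1).2⟩
  have hLip : LipschitzOnWith K Q D := LipschitzOnWith.of_dist_le_mul fun s hs t ht => by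
    rw [dist_eq_norm, dist_eq_norm]
    have := hPK _ (hQD s hs).1 _ (hQD t ht).1
    rwa [(hQD s hs).2, (hQD t ht).2] at this
  have hQm : Measurable Q := by
    have hc : ContinuousOn (Function.invFunOn P A) D :=
      hLip.continuousOn.congr fun t ht => (piecewise_eq_of_mem _ _ _ ht).symm
    exact hc.measurable_piecewise continuousOn_const hDm
  have himg : ∀ B, Q '' (Q ⁻¹' B ∩ D) = B ∩ A := fun B => by
    ext x
    constructor
    · rintro ⟨t, ⟨ht, htD⟩, rfl⟩
      exact ⟨ht, (hQD t htD).1⟩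
    · rintro ⟨hxB, hxA⟩
      exact ⟨P x, ⟨by rw [mem_preimage, (hQP x hxA).2]; exact hxB, (hQP x hxA).1⟩, (hQP x hxA).2⟩
  have himg' : ∀ B, P '' (B ∩ A) = Q ⁻¹' B ∩ D := fun B => by
    rw [← himg B, image_image]
    conv_rhs => rw [← image_id (Q ⁻¹' B ∩ D)]
    exact image_congr fun t ht => (hQD t ht.2).2
  refine ⟨Q, D, hQm, hDm, fun t ht => (hQD t ht).1, fun t ht => (hQD t ht).2, hQP, hLip,
    Measure.le_iff.2 fun B hB => ?_, Measure.le_iff.2 fun B hB => ?_⟩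
  · rw [Measure.map_apply hQm hB, Measure.restrict_apply (hQm hB), Measure.restrict_apply hB,
      ← himg' B, ← EuclideanSpace.euclideanHausdorffMeasure_eq_volume]
    have hl : LipschitzOnWith 1 P (B ∩ A) := LipschitzOnWith.of_dist_le_mul fun x _ y _ => by
      rw [dist_eq_norm, dist_eq_norm, ← map_sub]
      simpa using hP1 (x - y)
    simpa using hl.euclideanHausdorffMeasure_image_le m
  · rw [Measure.smul_apply, Measure.map_apply hQm hB, Measure.restrict_apply (hQm hB),
      Measure.restrict_apply hB, ← EuclideanSpace.euclideanHausdorffMeasure_eq_volume, ← himg B,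
      ENNReal.smul_def, smul_eq_mul, ENNReal.coe_pow]
    exact (hLip.mono inter_subset_right).euclideanHausdorffMeasure_image_le m

end Chart

section SigmaFinite

open Set

variable {m : ℕ}

/-- The surface measure of a `C¹` hypersurface is `σ`-finite; it need not be locally finite in the
ambient space, since the hypersurface need not be closed. -/
theorem IsC1Hypersurface.sigmaFinite_surfaceMeasure {S : Set (EuclideanSpace ℝ (Fin (m + 1)))}
    (hS : IsC1Hypersurface S)
    (hv : ∀ ξ ∈ S, ∃ w, IsUnitNormalAt S ξ w) : SigmaFinite (surfaceMeasure S) := by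
  obtain ⟨C, hC, hCV, hSC⟩ := exists_countable_open_cover (s := S)
    (P := fun V => surfaceMeasure S V < ⊤) fun p hp => by
      obtain ⟨w, hw⟩ := hv p hp
      obtain ⟨V, hV, hpV, hflat⟩ := hS.exists_flat_nhd hp hw (ε := 1 / 2) (by norm_num)
      refine ⟨V ∩ Metric.ball p 1, hV.inter Metric.isOpen_ball,
        ⟨hpV, Metric.mem_ball_self one_pos⟩, ?_⟩
      obtain ⟨e, P, hdec, horth⟩ := exists_hyperplane_coordinates hw.1
      have hVm : MeasurableSet (V ∩ Metric.ball p 1) :=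
        (hV.inter Metric.isOpen_ball).measurableSet
      obtain ⟨Q, D, hQ, hD, hQD, hPQ, -, -, -, hle⟩ := exists_flat_chart hw.1 hdec horth
        (A := S ∩ (V ∩ Metric.ball p 1)) (hS.measurableSet.inter hVm) (ε := 1 / 2) (K := 2)
        (by norm_num) fun x hx y hy => hflat x ⟨hx.1, hx.2.1⟩ y ⟨hy.1, hy.2.1⟩
      have hDb : volume D < ⊤ := by
        have : D ⊆ P '' Metric.closedBall p 1 := fun t ht =>
          ⟨Q t, Metric.ball_subset_closedBall (hQD ht).2.2, hPQ t ht⟩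
        exact (measure_mono this).trans_lt
          ((isCompact_closedBall p 1).image P.continuous).measure_lt_top
      have h := hle univ
      rw [Measure.restrict_apply_univ, Measure.smul_apply,
        Measure.map_apply hQ MeasurableSet.univ, preimage_univ, Measure.restrict_apply_univ] at h
      rw [surfaceMeasure, Measure.restrict_apply hVm, inter_comm]
      refine h.trans_lt ?_
      rw [ENNReal.smul_def, smul_eq_mul]
      exact ENNReal.mul_lt_top ENNReal.coe_lt_top hDb
  refine Measure.sigmaFinite_of_countable (S := insert Sᶜ C) (hC.insert _) ?_ ?_
  · rintro V (rfl | hV)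
    · rw [surfaceMeasure, Measure.restrict_apply hS.measurableSet.compl, compl_inter_self,
        measure_empty]
      exact ENNReal.zero_lt_top
    · exact (hCV V hV).2
  · rw [sUnion_insert, ← compl_subset_iff_union, compl_compl]
    exact hSC

end SigmaFinite

/-! ### The difference map on a product of hyperplanes -/

section LinearModel

open Set

variable {m : ℕ}

/-- Orthogonal coordinates `ℝ^m × ℝ → ℝ^(m+1)` preserve volume. -/
theorem measurePreserving_hyperplane_coordinates {w : EuclideanSpace ℝ (Fin (m + 1))}
    (hw : ‖w‖ = 1) {e : EuclideanSpace ℝ (Fin m) →ₗᵢ[ℝ] EuclideanSpace ℝ (Fin (m + 1))}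
    (horth : ∀ t, inner ℝ w (e t) = (0 : ℝ)) :
    MeasurePreserving (fun p : EuclideanSpace ℝ (Fin m) × ℝ => e p.1 + p.2 • w) := by
  let A : WithLp 2 (EuclideanSpace ℝ (Fin m) × ℝ) →ₗᵢ[ℝ] EuclideanSpace ℝ (Fin (m + 1)) :=
    { toLinearMap := (e.toLinearMap.comp (LinearMap.fst ℝ _ _) +
        (LinearMap.snd ℝ _ _).smulRight w).comp (WithLp.linearEquiv 2 ℝ _).toLinearMap
      norm_map' := fun p => by
        rw [← sq_eq_sq₀ (norm_nonneg _) (norm_nonneg _), WithLp.prod_norm_sq_eq_of_L2]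
        simp [norm_add_sq_real, inner_smul_right, real_inner_comm w, horth, norm_smul, hw] }
  have hfr : Module.finrank ℝ (WithLp 2 (EuclideanSpace ℝ (Fin m) × ℝ)) =
      Module.finrank ℝ (EuclideanSpace ℝ (Fin (m + 1))) := by
    rw [(WithLp.linearEquiv 2 ℝ (EuclideanSpace ℝ (Fin m) × ℝ)).finrank_eq]
    simp
  exact (A.toLinearIsometryEquiv hfr).measurePreserving.comp
    (WithLp.volume_preserving_toLp (EuclideanSpace ℝ (Fin m)) ℝ)

/-- The linear map with matrix rows `w j` scales volume by `|det w|`. -/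
theorem map_inner_volume_eq {n : ℕ} {w : Fin n → EuclideanSpace ℝ (Fin n)} (hw : wedgeAbs w ≠ 0) :
    (volume : Measure (EuclideanSpace ℝ (Fin n))).map (fun x j => (inner ℝ (w j) x : ℝ)) =
      (ENNReal.ofReal (wedgeAbs w))⁻¹ • volume := by
  set M : Matrix (Fin n) (Fin n) ℝ := Matrix.of fun i j => w i j with hM
  have hdet : M.det ≠ 0 := fun h => hw (by rw [wedgeAbs, ← hM, h, abs_zero])
  have h := Real.map_matrix_volume_pi_eq_smul_volume_pi hdet
  rw [abs_inv, ENNReal.ofReal_inv_of_pos (abs_pos.2 hdet)] at h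
  rw [wedgeAbs, ← hM, ← h, ← (PiLp.volume_preserving_ofLp (Fin n)).map_eq,
    Measure.map_map (by fun_prop) (by fun_prop)]
  congr 1
  ext x j
  simp [M, Matrix.toLin'_apply, Matrix.mulVec, dotProduct, PiLp.inner_apply, mul_comm]

theorem measurePreserving_shear {α G : Type*} [MeasurableSpace α] [MeasurableSpace G] [AddGroup G]
    [MeasurableAdd₂ G] [MeasurableNeg G] (μ : Measure α) [SFinite μ] (ν : Measure G) [SFinite ν]
    [ν.IsAddRightInvariant] {F : α → G} (hF : Measurable F) :
    MeasurePreserving (fun p : α × G => (p.1, p.2 - F p.1)) (μ.prod ν) (μ.prod ν) :=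
  (MeasurePreserving.id μ).skew_product (g := fun a c => c - F a)
    (measurable_snd.sub (hF.comp measurable_fst))
    (Filter.Eventually.of_forall fun a => map_sub_right_eq_self ν (F a))

/-- The map `(x₀, …, x_m) ↦ (x₀ - x_m, …, x_(m-1) - x_m)`. -/
def subLast {E : Type*} [Sub E] (x : Fin (m + 1) → E) (i : Fin m) : E :=
  x i.castSucc - x (Fin.last m)

/-- `(x₀, …, x_m) ↦ ((x_i - x_m)_(i < m), x_m)` preserves volume. -/
theorem measurePreserving_subLast_prod {n : ℕ} :
    MeasurePreserving (fun x : Fin (m + 1) → EuclideanSpace ℝ (Fin n) =>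
      (x (Fin.last m), subLast x)) := by
  have h1 := volume_preserving_piFinSuccAbove (fun _ => EuclideanSpace ℝ (Fin n)) (Fin.last m)
  have h2 := measurePreserving_shear (volume : Measure (EuclideanSpace ℝ (Fin n)))
    (volume : Measure (Fin m → EuclideanSpace ℝ (Fin n))) (F := fun a _ => a) (by fun_prop)
  have h3 := h2.comp h1
  refine Eq.subst (motive := fun F => MeasurePreserving F volume _) ?_ h3
  funext x
  simp [subLast, MeasurableEquiv.piFinSuccAbove, Fin.insertNthEquiv, Fin.init, funext_iff]

/-- The normal components of `x` are, for fixed differences `subLast x`, an affine function of the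
last vector `x_m` whose linear part has the normals `w j` as rows. Hence they may replace `x_m` as
coordinates, at the cost of the factor `wedgeAbs w`. -/
theorem measurePreserving_normal_components {w : Fin (m + 1) → EuclideanSpace ℝ (Fin (m + 1))}
    (hw : wedgeAbs w ≠ 0) :
    MeasurePreserving (fun x : Fin (m + 1) → EuclideanSpace ℝ (Fin (m + 1)) =>
      (subLast x, fun j => (inner ℝ (w j) (x j) : ℝ))) volume
      ((volume : Measure (Fin m → EuclideanSpace ℝ (Fin (m + 1)))).prod
        ((ENNReal.ofReal (wedgeAbs w))⁻¹ • volume)) := by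
  have h1 := (Measure.measurePreserving_swap
    (μ := (volume : Measure (EuclideanSpace ℝ (Fin (m + 1)))))
    (ν := (volume : Measure (Fin m → EuclideanSpace ℝ (Fin (m + 1)))))).comp
    (measurePreserving_subLast_prod (m := m) (n := m + 1))
  have hmeas : Measurable fun p : (Fin m → EuclideanSpace ℝ (Fin (m + 1))) ×
      EuclideanSpace ℝ (Fin (m + 1)) => fun j : Fin (m + 1) =>
        (inner ℝ (w j)
          (Fin.snoc (α := fun _ => EuclideanSpace ℝ (Fin (m + 1))) p.1 0 j + p.2) : ℝ) := by
    refine measurable_pi_iff.2 fun j => ?_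
    refine Fin.lastCases ?_ (fun i => ?_) j
    · simp only [Fin.snoc_last, zero_add]
      fun_prop
    · simp only [Fin.snoc_castSucc]
      fun_prop
  have h2 : MeasurePreserving (fun p : (Fin m → EuclideanSpace ℝ (Fin (m + 1))) ×
      EuclideanSpace ℝ (Fin (m + 1)) => (id p.1, fun j : Fin (m + 1) =>
        (inner ℝ (w j)
          (Fin.snoc (α := fun _ => EuclideanSpace ℝ (Fin (m + 1))) p.1 0 j + p.2) : ℝ)))
      (volume.prod volume)
      ((volume : Measure (Fin m → EuclideanSpace ℝ (Fin (m + 1)))).prod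
        ((ENNReal.ofReal (wedgeAbs w))⁻¹ • volume)) := by
    refine (MeasurePreserving.id volume).skew_product (g := fun u x => fun j : Fin (m + 1) =>
      (inner ℝ (w j) (Fin.snoc (α := fun _ => EuclideanSpace ℝ (Fin (m + 1))) u 0 j + x) : ℝ))
      hmeas (Filter.Eventually.of_forall fun u => ?_)
    rw [← map_inner_volume_eq hw]
    simp only [inner_add_right]
    set c : Fin (m + 1) → ℝ := fun j =>
      inner ℝ (w j) (Fin.snoc (α := fun _ => EuclideanSpace ℝ (Fin (m + 1))) u 0 j)
    have : (fun (x : EuclideanSpace ℝ (Fin (m + 1))) j => c j + (inner ℝ (w j) x : ℝ)) =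
        (fun y => c + y) ∘ fun x j => (inner ℝ (w j) x : ℝ) := rfl
    rw [this, ← Measure.map_map (by fun_prop) (by fun_prop), map_inner_volume_eq hw,
      Measure.map_smul, map_add_left_eq_self]
  refine Eq.subst (motive := fun F => MeasurePreserving F volume _) ?_ (h2.comp h1)
  refine funext fun x => Prod.ext rfl (funext fun j => ?_)
  refine Fin.lastCases ?_ (fun i => ?_) j
  · simp
  · simp [subLast]

/-- The difference map in tangential coordinates `t j` to the hyperplanes orthogonal to `w j`, with
the normal coordinates `s j` adjoined. -/
theorem measurePreserving_normal_tangential_components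
    {w : Fin (m + 1) → EuclideanSpace ℝ (Fin (m + 1))} (hw : wedgeAbs w ≠ 0)
    (hw1 : ∀ j, ‖w j‖ = 1)
    {e : Fin (m + 1) → EuclideanSpace ℝ (Fin m) →ₗᵢ[ℝ] EuclideanSpace ℝ (Fin (m + 1))}
    (horth : ∀ j t, inner ℝ (w j) (e j t) = (0 : ℝ)) :
    MeasurePreserving (fun p : (Fin (m + 1) → EuclideanSpace ℝ (Fin m)) × (Fin (m + 1) → ℝ) =>
        (p.2, subLast fun j => e j (p.1 j)))
      ((volume : Measure (Fin (m + 1) → EuclideanSpace ℝ (Fin m))).prod volume)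
      (((ENNReal.ofReal (wedgeAbs w))⁻¹ • volume).prod
        (volume : Measure (Fin m → EuclideanSpace ℝ (Fin (m + 1))))) := by
  have h1 : MeasurePreserving (fun p : (Fin (m + 1) → EuclideanSpace ℝ (Fin m)) ×
      (Fin (m + 1) → ℝ) => fun j => e j (p.1 j) + p.2 j • w j) :=
    (volume_preserving_pi fun j => measurePreserving_hyperplane_coordinates (hw1 j) (horth j)).comp
      (volume_measurePreserving_arrowProdEquivProdArrow (EuclideanSpace ℝ (Fin m)) ℝ
        (Fin (m + 1))).symm
  have h2 := (Measure.measurePreserving_swap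
      (μ := (volume : Measure (Fin m → EuclideanSpace ℝ (Fin (m + 1)))))
      (ν := (ENNReal.ofReal (wedgeAbs w))⁻¹ • (volume : Measure (Fin (m + 1) → ℝ)))).comp
    ((measurePreserving_normal_components hw).comp h1)
  have hshear : Measurable fun s : Fin (m + 1) → ℝ => subLast (m := m) fun j => s j • w j := by
    unfold subLast
    fun_prop
  have h3 := measurePreserving_shear ((ENNReal.ofReal (wedgeAbs w))⁻¹ • volume)
    (volume : Measure (Fin m → EuclideanSpace ℝ (Fin (m + 1)))) hshear
  refine Eq.subst (motive := fun F => MeasurePreserving F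
    ((volume : Measure (Fin (m + 1) → EuclideanSpace ℝ (Fin m))).prod volume) _) ?_ (h3.comp h2)
  refine funext fun p => Prod.ext ?_ ?_
  · funext j
    simp [inner_add_right, horth, inner_smul_right, hw1]
  · funext i
    simp only [subLast, Function.comp_apply, Prod.swap, Pi.sub_apply, inner_add_right, horth,
      inner_smul_right, real_inner_self_eq_norm_sq, hw1, zero_add, one_pow, mul_one]
    abel

/-- The Jacobian of the difference map on a product of hyperplanes. It is computed in codimension
zero: after adjoining the normal coordinates `s j` to the tangential coordinates `t j`, the map
becomes a composition of shears and of the linear map whose matrix has the normals as rows. -/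
theorem measurePreserving_subLast_hyperplanes
    {w : Fin (m + 1) → EuclideanSpace ℝ (Fin (m + 1))} (hw : wedgeAbs w ≠ 0)
    (hw1 : ∀ j, ‖w j‖ = 1)
    {e : Fin (m + 1) → EuclideanSpace ℝ (Fin m) →ₗᵢ[ℝ] EuclideanSpace ℝ (Fin (m + 1))}
    (horth : ∀ j t, inner ℝ (w j) (e j t) = (0 : ℝ)) :
    MeasurePreserving (fun t : Fin (m + 1) → EuclideanSpace ℝ (Fin m) =>
      subLast fun j => e j (t j)) volume
      ((ENNReal.ofReal (wedgeAbs w))⁻¹ • volume) := by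
  set L : (Fin (m + 1) → EuclideanSpace ℝ (Fin m)) → Fin m → EuclideanSpace ℝ (Fin (m + 1)) :=
    fun t => subLast fun j => e j (t j) with hL
  have hLm : Measurable L := by
    refine measurable_pi_iff.2 fun i => ?_
    exact (((e i.castSucc).continuous.comp (continuous_apply i.castSucc)).sub
      ((e (Fin.last m)).continuous.comp (continuous_apply (Fin.last m)))).measurable
  have h := measurePreserving_normal_tangential_components hw hw1 horth
  refine ⟨hLm, Measure.ext fun B hB => ?_⟩
  have h5 := h.measure_preimage
    ((MeasurableSet.univ_pi fun _ => measurableSet_Icc).prod hB :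
      MeasurableSet ((univ.pi fun _ : Fin (m + 1) => Icc (0 : ℝ) 1) ×ˢ B)).nullMeasurableSet
  have hpre : (fun p : (Fin (m + 1) → EuclideanSpace ℝ (Fin m)) × (Fin (m + 1) → ℝ) =>
      (p.2, L p.1)) ⁻¹' ((univ.pi fun _ : Fin (m + 1) => Icc (0 : ℝ) 1) ×ˢ B) =
      (L ⁻¹' B) ×ˢ (univ.pi fun _ : Fin (m + 1) => Icc (0 : ℝ) 1) := by
    ext ⟨t, s⟩
    exact and_comm
  rw [hpre, Measure.prod_prod, Measure.prod_prod, Measure.smul_apply, volume_pi_pi] at h5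
  rw [Measure.map_apply hLm hB]
  simpa using h5

/-- The difference map on a product of transversal hyperplanes is a linear isomorphism. -/
theorem exists_subLast_hyperplanes_equiv
    {w : Fin (m + 1) → EuclideanSpace ℝ (Fin (m + 1))} (hw : wedgeAbs w ≠ 0)
    {e : Fin (m + 1) → EuclideanSpace ℝ (Fin m) →ₗᵢ[ℝ] EuclideanSpace ℝ (Fin (m + 1))}
    (horth : ∀ j t, inner ℝ (w j) (e j t) = (0 : ℝ)) :
    ∃ L : (Fin (m + 1) → EuclideanSpace ℝ (Fin m)) ≃L[ℝ]
      (Fin m → EuclideanSpace ℝ (Fin (m + 1))), ∀ t, L t = subLast fun j => e j (t j) := by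
  let L : (Fin (m + 1) → EuclideanSpace ℝ (Fin m)) →ₗ[ℝ]
      (Fin m → EuclideanSpace ℝ (Fin (m + 1))) :=
    { toFun := fun t => subLast fun j => e j (t j)
      map_add' := fun t t' => by
        ext1 i; simp only [subLast, Pi.add_apply, map_add]; abel
      map_smul' := fun c t => by
        ext1 i; simp only [subLast, Pi.smul_apply, map_smul, RingHom.id_apply, smul_sub] }
  have hinj : Function.Injective L := by
    refine (injective_iff_map_eq_zero L).2 fun t ht => ?_
    set x := e (Fin.last m) (t (Fin.last m)) with hx
    have hall : ∀ j, e j (t j) = x := by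
      refine Fin.lastCases rfl fun i => ?_
      exact sub_eq_zero.1 (congrFun ht i)
    have hx0 : x = 0 := by
      have hdet : (Matrix.of fun i j : Fin (m + 1) => w i j).det ≠ 0 := fun h => hw (by
        rw [wedgeAbs, h, abs_zero])
      have hmul : (Matrix.of fun i j : Fin (m + 1) => w i j).mulVec x.ofLp = 0 := by
        ext j
        have := horth j (t j)
        rw [hall j, PiLp.inner_apply] at this
        simpa [Matrix.mulVec, dotProduct, mul_comm] using this
      have := Matrix.eq_zero_of_mulVec_eq_zero hdet hmul
      ext j
      exact congrFun this j
    ext1 j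
    have := hall j
    rw [hx0] at this
    exact (e j).injective (this.trans (map_zero _).symm)
  have hfr : Module.finrank ℝ (Fin (m + 1) → EuclideanSpace ℝ (Fin m)) =
      Module.finrank ℝ (Fin m → EuclideanSpace ℝ (Fin (m + 1))) := by
    simp [Module.finrank_pi_fintype, mul_comm]
  exact ⟨(LinearEquiv.ofInjectiveOfFinrankEq L hinj hfr).toContinuousLinearEquiv, fun t => rfl⟩

end LinearModel

/-! ### Product measures and perturbations of linear maps -/

section ProductMeasure

open Set
open scoped NNReal

variable {ι : Type*} [Fintype ι] {α : ι → Type*} [∀ i, MeasurableSpace (α i)]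

/-- Monotonicity of finite products of `σ`-finite measures. -/
theorem MeasureTheory.Measure.pi_le_pi {μ ν : ∀ i, Measure (α i)} [∀ i, SigmaFinite (μ i)]
    (h : ∀ i, μ i ≤ ν i) : Measure.pi μ ≤ Measure.pi ν := by
  refine Measure.le_iff.2 fun s hs => ?_
  rw [Measure.pi, Measure.pi, toMeasure_apply _ _ hs, toMeasure_apply _ _ hs]
  refine OuterMeasure.le_pi.2 (fun t ht => ?_) s
  exact (OuterMeasure.pi_pi_le _ _).trans (Finset.prod_le_prod' fun i _ => h i (t i))

theorem MeasureTheory.Measure.pi_smul_nnreal (ν : ∀ i, Measure (α i)) [∀ i, SigmaFinite (ν i)]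
    (c : ℝ≥0) : Measure.pi (fun i => c • ν i) = c ^ Fintype.card ι • Measure.pi ν := by
  refine Measure.pi_eq fun s _ => ?_
  simp only [Measure.smul_apply, Measure.pi_pi, ENNReal.smul_def, smul_eq_mul,
    Finset.prod_mul_distrib, Finset.prod_const, Finset.card_univ, ENNReal.coe_pow]

end ProductMeasure

section Jacobian

open Set Filter Topology
open scoped NNReal

variable {m : ℕ}

theorem wedgeAbs_eq_of_eq_or_eq_neg {n : ℕ} {w w' : Fin n → EuclideanSpace ℝ (Fin n)}
    (h : ∀ j, w j = w' j ∨ w j = -w' j) : wedgeAbs w = wedgeAbs w' := by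
  have hs : ∀ j, ∃ s : ℝ, |s| = 1 ∧ w j = s • w' j := fun j => by
    rcases h j with h | h
    · exact ⟨1, by simp, by simp [h]⟩
    · exact ⟨-1, by simp, by simp [h]⟩
  choose s hs1 hs2 using hs
  have : (Matrix.of fun i j : Fin n => w i j) =
      Matrix.of fun i j : Fin n => s i * (Matrix.of fun i j : Fin n => w' i j) i j := by
    ext i j
    simp [hs2 i]
  rw [wedgeAbs, wedgeAbs, this, Matrix.det_mul_column, abs_mul, Finset.abs_prod]
  simp [hs1]

theorem continuous_wedgeAbs {n : ℕ} :
    Continuous (wedgeAbs : (Fin n → EuclideanSpace ℝ (Fin n)) → ℝ) := by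
  unfold wedgeAbs
  refine continuous_abs.comp (Continuous.matrix_det ?_)
  refine continuous_matrix fun i j => ?_
  simp only [Matrix.of_apply]
  fun_prop

/-- The transversality factor is continuous along the product of the hypersurfaces, although the
choice of unit normals is arbitrary: it does not depend on their signs. -/
theorem continuousOn_wedgeAbs_normal {n : ℕ} {S : Fin n → Set (EuclideanSpace ℝ (Fin n))}
    (hS : ∀ j, IsC1Hypersurface (S j))
    {v : Fin n → EuclideanSpace ℝ (Fin n) → EuclideanSpace ℝ (Fin n)}
    (hv : ∀ j, ∀ ξ ∈ S j, IsUnitNormalAt (S j) ξ (v j ξ)) :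
    ContinuousOn (fun ξ : Fin n → EuclideanSpace ℝ (Fin n) => wedgeAbs fun j => v j (ξ j))
      (univ.pi S) := by
  intro ξ hξ
  choose U hU hξU N hN hNv using fun j => (hS j).exists_continuousOn_normal (hξ j (mem_univ j))
  have hopen : IsOpen (univ.pi U) := isOpen_set_pi finite_univ fun j _ => hU j
  have hc : ContinuousAt (fun ξ : Fin n → EuclideanSpace ℝ (Fin n) =>
      wedgeAbs fun j => N j (ξ j)) ξ :=
    continuous_wedgeAbs.continuousAt.comp (continuousAt_pi.2 fun j =>
      ContinuousAt.comp (f := fun ζ : Fin n → EuclideanSpace ℝ (Fin n) => ζ j)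
        ((hN j).continuousAt ((hU j).mem_nhds (hξU j))) (continuous_apply j).continuousAt)
  refine hc.continuousWithinAt.congr_of_eventuallyEq ?_ ?_
  · filter_upwards [self_mem_nhdsWithin,
      mem_nhdsWithin_of_mem_nhds (hopen.mem_nhds fun j _ => hξU j)] with ζ hζ hζU
    exact wedgeAbs_eq_of_eq_or_eq_neg fun j =>
      hNv j _ ⟨hζ j trivial, hζU j trivial⟩ _ (hv j _ (hζ j trivial))
  · exact wedgeAbs_eq_of_eq_or_eq_neg fun j =>
      hNv j _ ⟨hξ j trivial, hξU j⟩ _ (hv j _ (hξ j trivial))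

end Jacobian

section LocalComparison

open Set Filter Topology
open scoped NNReal

variable {m : ℕ}

theorem norm_subLast_le {E : Type*} [SeminormedAddCommGroup E] {x : Fin (m + 1) → E} {r : ℝ}
    (hr : 0 ≤ r) (hx : ∀ j, ‖x j‖ ≤ r) : ‖subLast x‖ ≤ 2 * r := by
  refine (pi_norm_le_iff_of_nonneg (by positivity)).2 fun i => ?_
  calc ‖x i.castSucc - x (Fin.last m)‖ ≤ ‖x i.castSucc‖ + ‖x (Fin.last m)‖ := norm_sub_le _ _
    _ ≤ r + r := add_le_add (hx _) (hx _)
    _ = 2 * r := by ring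

/-- On a product of almost flat charts, the difference map is a small perturbation of the linear
difference map on the tangent hyperplanes. -/
theorem approximatesLinearOn_subLast_chart {w : Fin (m + 1) → EuclideanSpace ℝ (Fin (m + 1))}
    (hw1 : ∀ j, ‖w j‖ = 1)
    {e : Fin (m + 1) → EuclideanSpace ℝ (Fin m) →ₗᵢ[ℝ] EuclideanSpace ℝ (Fin (m + 1))}
    {P : Fin (m + 1) → EuclideanSpace ℝ (Fin (m + 1)) →L[ℝ] EuclideanSpace ℝ (Fin m)}
    (hdec : ∀ j x, x = e j (P j x) + (inner ℝ (w j) x : ℝ) • w j)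
    {L : (Fin (m + 1) → EuclideanSpace ℝ (Fin m)) ≃L[ℝ]
      (Fin m → EuclideanSpace ℝ (Fin (m + 1)))} (hL : ∀ t, L t = subLast fun j => e j (t j))
    {A : Fin (m + 1) → Set (EuclideanSpace ℝ (Fin (m + 1)))} {ε : ℝ} (hε : 0 ≤ ε)
    (hflat : ∀ j, ∀ x ∈ A j, ∀ y ∈ A j, |inner ℝ (w j) (x - y)| ≤ ε * ‖x - y‖)
    {Q : Fin (m + 1) → EuclideanSpace ℝ (Fin m) → EuclideanSpace ℝ (Fin (m + 1))}
    {D : Fin (m + 1) → Set (EuclideanSpace ℝ (Fin m))} (hQD : ∀ j, MapsTo (Q j) (D j) (A j))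
    (hPQ : ∀ j, ∀ t ∈ D j, P j (Q j t) = t) {K : ℝ≥0} (hLip : ∀ j, LipschitzOnWith K (Q j) (D j))
    {δ : ℝ≥0}
    (hδ : ‖(L.symm : (Fin m → EuclideanSpace ℝ (Fin (m + 1))) →L[ℝ]
      (Fin (m + 1) → EuclideanSpace ℝ (Fin m)))‖ * (2 * (ε * K)) ≤ δ) :
    ApproximatesLinearOn (fun t => L.symm (subLast fun j => Q j (t j)))
      (ContinuousLinearMap.id ℝ (Fin (m + 1) → EuclideanSpace ℝ (Fin m))) (univ.pi D) δ := by
  intro t ht s hs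
  set r : Fin (m + 1) → EuclideanSpace ℝ (Fin (m + 1)) := fun j =>
    Q j (t j) - Q j (s j) - e j (t j - s j) with hr
  have hrw : L.symm (subLast fun j => Q j (t j)) - L.symm (subLast fun j => Q j (s j)) -
      (ContinuousLinearMap.id ℝ _) (t - s) = L.symm (subLast r) := by
    have : (ContinuousLinearMap.id ℝ (Fin (m + 1) → EuclideanSpace ℝ (Fin m))) (t - s) =
        L.symm (L (t - s)) := by simp
    rw [this, ← map_sub, ← map_sub, hL]
    congr 1
    ext1 i
    simp only [subLast, hr, Pi.sub_apply]
    abel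
  have hrj : ∀ j, ‖r j‖ ≤ ε * K * ‖t - s‖ := fun j => by
    have h1 := hdec j (Q j (t j) - Q j (s j))
    rw [map_sub, hPQ j _ (ht j trivial), hPQ j _ (hs j trivial)] at h1
    have h2 : r j = (inner ℝ (w j) (Q j (t j) - Q j (s j)) : ℝ) • w j := by
      rw [hr]
      exact sub_eq_of_eq_add' h1
    rw [h2, norm_smul, hw1, mul_one, Real.norm_eq_abs]
    calc |inner ℝ (w j) (Q j (t j) - Q j (s j))|
        ≤ ε * ‖Q j (t j) - Q j (s j)‖ :=
          hflat j _ (hQD j (ht j trivial)) _ (hQD j (hs j trivial))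
      _ ≤ ε * (K * ‖t j - s j‖) := by
          gcongr
          simpa only [dist_eq_norm] using
            (hLip j).dist_le_mul _ (ht j trivial) _ (hs j trivial)
      _ ≤ ε * (K * ‖t - s‖) := by
          gcongr
          exact norm_le_pi_norm (t - s) j
      _ = ε * K * ‖t - s‖ := by ring
  rw [hrw]
  calc ‖L.symm (subLast r)‖
      ≤ ‖(L.symm : (Fin m → EuclideanSpace ℝ (Fin (m + 1))) →L[ℝ]
          (Fin (m + 1) → EuclideanSpace ℝ (Fin m)))‖ * ‖subLast r‖ :=
        ContinuousLinearMap.le_opNorm (L.symm : (Fin m → EuclideanSpace ℝ (Fin (m + 1))) →L[ℝ]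
          (Fin (m + 1) → EuclideanSpace ℝ (Fin m))) (subLast r)
    _ ≤ ‖(L.symm : (Fin m → EuclideanSpace ℝ (Fin (m + 1))) →L[ℝ]
          (Fin (m + 1) → EuclideanSpace ℝ (Fin m)))‖ * (2 * (ε * K * ‖t - s‖)) := by
        gcongr
        exact norm_subLast_le (by positivity) hrj
    _ = ‖(L.symm : (Fin m → EuclideanSpace ℝ (Fin (m + 1))) →L[ℝ]
          (Fin (m + 1) → EuclideanSpace ℝ (Fin m)))‖ * (2 * (ε * K)) * ‖t - s‖ := by ring
    _ ≤ δ * ‖t - s‖ := by gcongr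

/-- A map sufficiently close to the identity almost preserves Lebesgue measure. -/
theorem exists_approximatesLinearOn_id_volume_bounds {E : Type*} [NormedAddCommGroup E]
    [NormedSpace ℝ E] [FiniteDimensional ℝ E] [MeasurableSpace E] [BorelSpace E] (μ : Measure E)
    [μ.IsAddHaarMeasure] {b : ℝ≥0} (hb : 1 < b) :
    ∃ δ : ℝ≥0, 0 < δ ∧ ∀ (s : Set E) (f : E → E),
      ApproximatesLinearOn f (ContinuousLinearMap.id ℝ E) s δ →
        μ (f '' s) ≤ b * μ s ∧ μ s ≤ b * μ (f '' s) := by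
  have hdet : (ContinuousLinearMap.id ℝ E).det = 1 := by
    simp [ContinuousLinearMap.det]
  have h1 := addHaar_image_le_mul_of_det_lt μ (ContinuousLinearMap.id ℝ E) (m := b) (by
    rw [hdet]; simpa using hb)
  have h2 := mul_le_addHaar_image_of_lt_det μ (ContinuousLinearMap.id ℝ E) (m := b⁻¹) (by
    rw [hdet]
    simpa using inv_lt_one_of_one_lt₀ hb)
  obtain ⟨δ, ⟨h1, h2⟩, hδ⟩ := ((h1.and h2).and self_mem_nhdsWithin).exists
  refine ⟨δ, hδ, fun s f hf => ⟨h1 s f hf, ?_⟩⟩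
  have hb0 : b ≠ 0 := (zero_lt_one.trans hb).ne'
  have h := h2 s f hf
  calc μ s = b * (((b⁻¹ : ℝ≥0) : ℝ≥0∞) * μ s) := by
        rw [← mul_assoc, ← ENNReal.coe_mul, mul_inv_cancel₀ hb0, ENNReal.coe_one, one_mul]
    _ ≤ b * μ (f '' s) := by gcongr

end LocalComparison

/-! ### Local volume distortion of the difference map -/

section LocalDistortion

open Set Filter Topology
open scoped NNReal

variable {m : ℕ}

/-- For `b > 1` there is a Lipschitz constant `K > 1` with `K ^ N ≤ b`, an `ε > 0` with
`1 / (1 - ε) ≤ K`, and `ε` may be taken so small that `C ε K ≤ δ`. -/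
theorem exists_flatness_constants {b δ : ℝ≥0} (hb : 1 < b) (hδ : 0 < δ) (N : ℕ) (C : ℝ) :
    ∃ (K : ℝ≥0) (ε : ℝ), 1 < K ∧ 0 < ε ∧ K ^ N ≤ b ∧ 1 ≤ K * (1 - ε) ∧ C * (2 * (ε * K)) ≤ δ := by
  have hN : ((N : ℝ) + 1) ≠ 0 := by positivity
  set K : ℝ≥0 := b ^ ((N : ℝ) + 1)⁻¹ with hK
  have hK1 : 1 < K := NNReal.one_lt_rpow hb (by positivity)
  have hKN : K ^ N ≤ b := by
    calc K ^ N ≤ K ^ (N + 1) := pow_le_pow_right₀ hK1.le N.le_succ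
      _ = b := by
        rw [hK, ← NNReal.rpow_natCast, ← NNReal.rpow_mul]
        push_cast
        rw [inv_mul_cancel₀ hN, NNReal.rpow_one]
  have hK1' : (1 : ℝ) < K := by exact_mod_cast hK1
  have h1 : Tendsto (fun ε : ℝ => (K : ℝ) * (1 - ε)) (𝓝[>] 0) (𝓝 (K * (1 - 0))) :=
    (Continuous.tendsto (by fun_prop) 0).mono_left nhdsWithin_le_nhds
  have h2 : Tendsto (fun ε : ℝ => C * (2 * (ε * K))) (𝓝[>] 0) (𝓝 (C * (2 * (0 * K)))) :=
    (Continuous.tendsto (by fun_prop) 0).mono_left nhdsWithin_le_nhds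
  have h3 := h1.eventually (lt_mem_nhds (show (1 : ℝ) < K * (1 - 0) by simpa using hK1'))
  have h4 := h2.eventually (gt_mem_nhds (show C * (2 * (0 * K)) < (δ : ℝ) by simpa using hδ))
  obtain ⟨ε, ⟨h3, h4⟩, hε⟩ := ((h3.and h4).and self_mem_nhdsWithin).exists
  exact ⟨K, ε, hK1, hε, hKN, h3.le, h4.le⟩

/-- Near a point of the product of the hypersurfaces, the difference map multiplies the product of
the surface measures by the transversality factor at that point, up to a factor close to one. -/
theorem exists_nhd_volume_image_subLast_bounds
    {S : Fin (m + 1) → Set (EuclideanSpace ℝ (Fin (m + 1)))} (hS : ∀ j, IsC1Hypersurface (S j))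
    [∀ j, SigmaFinite (surfaceMeasure (S j))]
    {ξ w : Fin (m + 1) → EuclideanSpace ℝ (Fin (m + 1))} (hξ : ∀ j, ξ j ∈ S j)
    (hw : ∀ j, IsUnitNormalAt (S j) (ξ j) (w j)) (hT : wedgeAbs w ≠ 0) {b : ℝ≥0} (hb : 1 < b) :
    ∃ V : Set (Fin (m + 1) → EuclideanSpace ℝ (Fin (m + 1))), IsOpen V ∧ ξ ∈ V ∧
      ∀ A ⊆ univ.pi S ∩ V, MeasurableSet A →
        volume (subLast '' A) ≤ b * (ENNReal.ofReal (wedgeAbs w) *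
          Measure.pi (fun j => surfaceMeasure (S j)) A) ∧
        ENNReal.ofReal (wedgeAbs w) * Measure.pi (fun j => surfaceMeasure (S j)) A ≤
          b ^ 2 * volume (subLast '' A) := by
  have hw1 : ∀ j, ‖w j‖ = 1 := fun j => (hw j).1
  choose e P hdec horth using fun j => exists_hyperplane_coordinates (hw1 j)
  obtain ⟨L, hL⟩ := exists_subLast_hyperplanes_equiv hT horth
  have hLmp := measurePreserving_subLast_hyperplanes hT hw1 horth
  obtain ⟨δ, hδ, hbounds⟩ := exists_approximatesLinearOn_id_volume_bounds
    (volume : Measure (Fin (m + 1) → EuclideanSpace ℝ (Fin m))) hb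
  obtain ⟨K, ε, -, hε, hKb, hK, hKδ⟩ := exists_flatness_constants hb hδ (m * (m + 1))
    ‖(L.symm : (Fin m → EuclideanSpace ℝ (Fin (m + 1))) →L[ℝ]
      (Fin (m + 1) → EuclideanSpace ℝ (Fin m)))‖
  choose V hV hξV hflat using fun j => (hS j).exists_flat_nhd (hξ j) (hw j) hε
  choose Q D hQ hD hQD hPQ hQP hLip hle1 hle2 using fun j =>
    exists_flat_chart (hw1 j) (hdec j) (horth j)
      ((hS j).measurableSet.inter (hV j).measurableSet) hK (hflat j)
  -- `τ j` is flat measure transported to `S j`; it equals the surface measure up to `K ^ m`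
  set τ : ∀ j : Fin (m + 1), Measure (EuclideanSpace ℝ (Fin (m + 1))) :=
    fun j => (volume.restrict (D j)).map (Q j) with hτ
  have hσV : ∀ j, (Measure.euclideanHausdorffMeasure m).restrict (S j ∩ V j) =
      (surfaceMeasure (S j)).restrict (V j) := fun j => by
    rw [surfaceMeasure, Measure.restrict_restrict (hV j).measurableSet, inter_comm]
  have hτσ : ∀ j, τ j ≤ (surfaceMeasure (S j)).restrict (V j) := fun j => hσV j ▸ hle1 j
  have hστ : ∀ j, (surfaceMeasure (S j)).restrict (V j) ≤ (K ^ m) • τ j := fun j =>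
    hσV j ▸ hle2 j
  have hτs : ∀ j, SigmaFinite (τ j) := fun j => Measure.sigmaFinite_of_le _ (hτσ j)
  have hVm : MeasurableSet (univ.pi V) := MeasurableSet.univ_pi fun j => (hV j).measurableSet
  have hpi1 : Measure.pi τ ≤ (Measure.pi fun j => surfaceMeasure (S j)).restrict (univ.pi V) := by
    rw [Measure.restrict_pi_pi]
    exact Measure.pi_le_pi hτσ
  have hpi2 : (Measure.pi fun j => surfaceMeasure (S j)).restrict (univ.pi V) ≤
      b • Measure.pi τ := by
    rw [Measure.restrict_pi_pi]
    refine (Measure.pi_le_pi hστ).trans ?_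
    rw [Measure.pi_smul_nnreal, Fintype.card_fin, ← pow_mul]
    refine Measure.le_iff.2 fun s _ => ?_
    simp only [Measure.smul_apply, ENNReal.smul_def, smul_eq_mul]
    gcongr
  set Qp : (Fin (m + 1) → EuclideanSpace ℝ (Fin m)) →
      Fin (m + 1) → EuclideanSpace ℝ (Fin (m + 1)) := fun t j => Q j (t j) with hQp
  have hQpm : Measurable Qp := measurable_pi_iff.2 fun j => (hQ j).comp (measurable_pi_apply j)
  have hτpi : Measure.pi τ = (volume.restrict (univ.pi D)).map Qp := by
    rw [volume_pi, Measure.restrict_pi_pi, hτ]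
    exact (Measure.pi_map_pi fun j => (hQ j).aemeasurable).symm
  refine ⟨univ.pi V, isOpen_set_pi finite_univ fun j _ => hV j, fun j _ => hξV j,
    fun A hA hAm => ?_⟩
  set B := Qp ⁻¹' A ∩ univ.pi D with hB
  have hτA : Measure.pi τ A = volume B := by
    rw [hτpi, Measure.map_apply hQpm hAm, Measure.restrict_apply (hQpm hAm)]
  have hAB : Qp '' B = A := by
    refine Subset.antisymm (image_subset_iff.2 inter_subset_left) fun ζ hζ => ?_
    have hζ' : ∀ j, ζ j ∈ S j ∩ V j := fun j => ⟨(hA hζ).1 j trivial, (hA hζ).2 j trivial⟩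
    have hQζ : Qp (fun j => P j (ζ j)) = ζ := funext fun j => (hQP j _ (hζ' j)).2
    exact ⟨fun j => P j (ζ j), ⟨by rw [mem_preimage, hQζ]; exact hζ,
      fun j _ => (hQP j _ (hζ' j)).1⟩, hQζ⟩
  have hpiA : (Measure.pi fun j => surfaceMeasure (S j)).restrict (univ.pi V) A =
      Measure.pi (fun j => surfaceMeasure (S j)) A := by
    rw [Measure.restrict_apply hAm, inter_eq_left.2 fun ζ hζ => (hA hζ).2]
  have hA1 : volume B ≤ Measure.pi (fun j => surfaceMeasure (S j)) A := by
    rw [← hτA, ← hpiA]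
    exact hpi1 A
  have hA2 : Measure.pi (fun j => surfaceMeasure (S j)) A ≤ b * volume B := by
    rw [← hτA, ← hpiA]
    exact hpi2 A
  -- the linear isomorphism `L` carries the comparison with the identity over to `subLast`
  have hJ0 : ENNReal.ofReal (wedgeAbs w) ≠ 0 := by
    have : 0 < wedgeAbs w := lt_of_le_of_ne (abs_nonneg _) (Ne.symm hT)
    simpa using this
  have hvol : volume (subLast '' A) = ENNReal.ofReal (wedgeAbs w) *
      volume ((fun t => L.symm (subLast fun j => Q j (t j))) '' B) := by
    have hLfun : (fun t : Fin (m + 1) → EuclideanSpace ℝ (Fin m) =>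
        (subLast fun j => e j (t j) : Fin m → EuclideanSpace ℝ (Fin (m + 1)))) =
          L.toHomeomorph.toMeasurableEquiv := funext fun t => (hL t).symm
    have h1 := congrArg (fun μ => μ (subLast '' A)) hLmp.map_eq
    rw [hLfun] at h1
    simp only [MeasurableEquiv.map_apply, Measure.smul_apply, smul_eq_mul] at h1
    have h2 : L.toHomeomorph.toMeasurableEquiv ⁻¹' (subLast '' A) =
        (fun t => L.symm (subLast fun j => Q j (t j))) '' B := by
      rw [← hAB, image_image]
      have : ∀ X : Set (Fin m → EuclideanSpace ℝ (Fin (m + 1))),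
          L.toHomeomorph.toMeasurableEquiv ⁻¹' X = L.symm '' X := fun X =>
        (L.toEquiv.image_symm_eq_preimage X).symm
      rw [this, image_image]
    rw [← h2, h1, ← mul_assoc, ENNReal.mul_inv_cancel hJ0 ENNReal.ofReal_ne_top, one_mul]
  obtain ⟨hb1, hb2⟩ := hbounds B _ ((approximatesLinearOn_subLast_chart hw1 hdec hL hε.le hflat hQD
    hPQ hLip hKδ).mono_set inter_subset_right)
  constructor
  · calc volume (subLast '' A) ≤ ENNReal.ofReal (wedgeAbs w) * (b * volume B) := by
          rw [hvol]; gcongr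
      _ ≤ ENNReal.ofReal (wedgeAbs w) *
          (b * Measure.pi (fun j => surfaceMeasure (S j)) A) := by gcongr
      _ = _ := mul_left_comm _ _ _
  · calc ENNReal.ofReal (wedgeAbs w) * Measure.pi (fun j => surfaceMeasure (S j)) A
        ≤ ENNReal.ofReal (wedgeAbs w) * (b * (b *
          volume ((fun t => L.symm (subLast fun j => Q j (t j))) '' B))) := by
          gcongr
          exact hA2.trans (by gcongr)
      _ = b ^ 2 * volume (subLast '' A) := by rw [hvol]; ring

end LocalDistortion

/-! ### Change of variables by the difference map -/

section LocalToGlobal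

open Set Filter Topology
open scoped NNReal

/-- A measure `μ` concentrated on `s` is dominated by `ν` as soon as it is so locally up to factors
arbitrarily close to one. -/
theorem MeasureTheory.Measure.le_of_forall_nhd_le_mul {Z : Type*} [TopologicalSpace Z]
    [SecondCountableTopology Z] [MeasurableSpace Z] [OpensMeasurableSpace Z] {μ ν : Measure Z}
    {s : Set Z} (hsm : MeasurableSet s) (hs : μ sᶜ = 0)
    (h : ∀ x ∈ s, ∀ c : ℝ≥0, 1 < c → ∃ V : Set Z, IsOpen V ∧ x ∈ V ∧
      ∀ A ⊆ s ∩ V, MeasurableSet A → μ A ≤ c * ν A) : μ ≤ ν := by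
  have key : ∀ c : ℝ≥0, 1 < c → ∀ A, MeasurableSet A → μ A ≤ c * ν A := fun c hc A hA => by
    obtain ⟨C, hC, hCV, hsC⟩ := exists_countable_open_cover (s := s)
      (P := fun V => ∀ A ⊆ s ∩ V, MeasurableSet A → μ A ≤ c * ν A) fun x hx => h x hx c hc
    obtain ⟨f, hf⟩ := (hC.insert ∅).exists_eq_range (insert_nonempty _ _)
    have hfV : ∀ n, IsOpen (f n) ∧ ∀ A ⊆ s ∩ f n, MeasurableSet A → μ A ≤ c * ν A := fun n => by
      rcases (hf ▸ mem_range_self n : f n ∈ insert ∅ C) with h0 | h0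
      · rw [h0]
        refine ⟨isOpen_empty, fun A hA _ => ?_⟩
        rw [inter_empty, subset_empty_iff] at hA
        simp [hA]
      · exact hCV _ h0
    have hcov : s ⊆ ⋃ n, disjointed f n := by
      rw [iUnion_disjointed, ← sUnion_range, ← hf, sUnion_insert, empty_union]
      exact hsC
    have hdm : ∀ n, MeasurableSet (A ∩ s ∩ disjointed f n) := fun n =>
      (hA.inter hsm).inter (MeasurableSet.disjointed (fun n => (hfV n).1.measurableSet) n)
    calc μ A ≤ μ (A ∩ s) := by
          rw [← measure_inter_add_sdiff A hsm, sdiff_eq]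
          rw [measure_mono_null inter_subset_right hs, add_zero]
      _ ≤ μ (⋃ n, A ∩ s ∩ disjointed f n) := by
          refine measure_mono fun x hx => ?_
          rw [← inter_iUnion]
          exact ⟨hx, hcov hx.2⟩
      _ ≤ ∑' n, μ (A ∩ s ∩ disjointed f n) := measure_iUnion_le _
      _ ≤ ∑' n, c * ν (A ∩ s ∩ disjointed f n) := ENNReal.tsum_le_tsum fun n =>
          (hfV n).2 _ (fun x hx => ⟨hx.1.2, disjointed_subset f n hx.2⟩) (hdm n)
      _ = c * ν (⋃ n, A ∩ s ∩ disjointed f n) := by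
          rw [ENNReal.tsum_mul_left, measure_iUnion _ hdm]
          exact fun i j hij =>
            (disjoint_disjointed f hij).mono inter_subset_right inter_subset_right
      _ ≤ c * ν A := by
          gcongr
          exact iUnion_subset fun n x hx => hx.1.1
  refine Measure.le_iff.2 fun A hA => ?_
  have hlim : Tendsto (fun c : ℝ≥0 => (c : ℝ≥0∞) * ν A) (𝓝[>] 1) (𝓝 (((1 : ℝ≥0) : ℝ≥0∞) * ν A)) :=
    ENNReal.Tendsto.mul_const
      ((ENNReal.continuous_coe.tendsto 1).mono_left nhdsWithin_le_nhds) (Or.inl (by simp))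
  have := ge_of_tendsto hlim (by
    filter_upwards [self_mem_nhdsWithin] with c hc using key c hc A hA)
  simpa using this

end LocalToGlobal

section ChangeOfVariables

open Set Filter Topology
open scoped NNReal

variable {m : ℕ}

theorem continuous_subLast {E : Type*} [NormedAddCommGroup E] :
    Continuous (subLast : (Fin (m + 1) → E) → Fin m → E) := by
  unfold subLast
  fun_prop

/-- By the Lusin–Souslin theorem, a continuous injection on a Borel set has a Borel inverse. -/
theorem exists_measurable_leftInverse {E : Type*} [NormedAddCommGroup E] [MeasurableSpace E]
    [BorelSpace E] [SecondCountableTopology E] [CompleteSpace E] {F : Type*} [TopologicalSpace F]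
    [T2Space F] [SecondCountableTopology F] [MeasurableSpace F] [BorelSpace F] {X : Set E}
    (hX : MeasurableSet X) {p : E → F} (hp : ContinuousOn p X) (hinj : InjOn p X) :
    ∃ R : F → E, Measurable R ∧ ∀ ζ ∈ X, R (p ζ) = ζ := by
  have hemb : MeasurableEmbedding (X.domRestrict p) := hp.measurableEmbedding hX hinj
  obtain ⟨R, hRm, hR⟩ := hemb.exists_measurable_extend measurable_subtype_coe fun _ => ⟨0⟩
  exact ⟨R, hRm, fun ζ hζ => congrFun hR ⟨ζ, hζ⟩⟩

theorem restrict_pi_surfaceMeasure {S : Fin (m + 1) → Set (EuclideanSpace ℝ (Fin (m + 1)))}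
    (hS : ∀ j, IsC1Hypersurface (S j)) [∀ j, SigmaFinite (surfaceMeasure (S j))] :
    (Measure.pi fun j => surfaceMeasure (S j)).restrict (univ.pi S) =
      Measure.pi fun j => surfaceMeasure (S j) := by
  rw [Measure.restrict_pi_pi]
  congr 1
  ext1 j
  rw [surfaceMeasure, Measure.restrict_restrict (hS j).measurableSet, inter_self]

variable {S : Fin (m + 1) → Set (EuclideanSpace ℝ (Fin (m + 1)))}
  {v : Fin (m + 1) → EuclideanSpace ℝ (Fin (m + 1)) → EuclideanSpace ℝ (Fin (m + 1))}

/-- Local form of the change of variables, with the transversality factor under the integral. -/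
theorem exists_nhd_volume_image_subLast_le_lintegral (hS : ∀ j, IsC1Hypersurface (S j))
    [∀ j, SigmaFinite (surfaceMeasure (S j))]
    (hv : ∀ j, ∀ ξ ∈ S j, IsUnitNormalAt (S j) ξ (v j ξ))
    (hT : ∀ ξ : Fin (m + 1) → EuclideanSpace ℝ (Fin (m + 1)), (∀ j, ξ j ∈ S j) →
      wedgeAbs (fun j => v j (ξ j)) ≠ 0)
    {ξ : Fin (m + 1) → EuclideanSpace ℝ (Fin (m + 1))} (hξ : ξ ∈ univ.pi S) {c : ℝ≥0}
    (hc : 1 < c) :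
    ∃ V : Set (Fin (m + 1) → EuclideanSpace ℝ (Fin (m + 1))), IsOpen V ∧ ξ ∈ V ∧
      ∀ A ⊆ univ.pi S ∩ V, MeasurableSet A →
        volume (subLast '' A) ≤ c * ∫⁻ ζ in A, ENNReal.ofReal (wedgeAbs fun j => v j (ζ j))
          ∂(Measure.pi fun j => surfaceMeasure (S j)) ∧
        ∫⁻ ζ in A, ENNReal.ofReal (wedgeAbs fun j => v j (ζ j))
          ∂(Measure.pi fun j => surfaceMeasure (S j)) ≤ c * volume (subLast '' A) := by
  -- two factors `b` for the distortion and one for the variation of `J`, so `b ^ 3 ≤ c` suffices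
  obtain ⟨b, -, hb, -, hbc, -, -⟩ := exists_flatness_constants hc one_pos 3 0
  set J : (Fin (m + 1) → EuclideanSpace ℝ (Fin (m + 1))) → ℝ≥0∞ :=
    fun ζ => ENNReal.ofReal (wedgeAbs fun j => v j (ζ j)) with hJ
  have hξ' : ∀ j, ξ j ∈ S j := fun j => hξ j trivial
  obtain ⟨V, hV, hξV, hVb⟩ := exists_nhd_volume_image_subLast_bounds hS hξ'
    (fun j => hv j _ (hξ' j)) (hT ξ hξ') hb
  have hJc : ContinuousOn J (univ.pi S) :=
    ENNReal.continuous_ofReal.comp_continuousOn (continuousOn_wedgeAbs_normal hS hv)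
  have hJ0 : J ξ ≠ 0 := by
    have : 0 < wedgeAbs fun j => v j (ξ j) := lt_of_le_of_ne (abs_nonneg _) (Ne.symm (hT ξ hξ'))
    simpa [hJ] using this
  have hJt : J ξ ≠ ⊤ := ENNReal.ofReal_ne_top
  have hb1 : (1 : ℝ≥0∞) < b := by exact_mod_cast hb
  have hlt1 : J ξ < b * J ξ := by
    simpa using ENNReal.mul_lt_mul_left hJ0 hJt hb1
  have hlt2 : ∀ᶠ ζ in 𝓝[univ.pi S] ξ, J ξ < b * J ζ := by
    have : Tendsto (fun ζ => (b : ℝ≥0∞) * J ζ) (𝓝[univ.pi S] ξ) (𝓝 (b * J ξ)) :=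
      ENNReal.Tendsto.const_mul (hJc ξ hξ) (Or.inr ENNReal.coe_ne_top)
    exact this.eventually (lt_mem_nhds hlt1)
  have hlt3 : ∀ᶠ ζ in 𝓝[univ.pi S] ξ, J ζ < b * J ξ := (hJc ξ hξ).eventually (gt_mem_nhds hlt1)
  obtain ⟨U, hU, hξU, hUb⟩ := mem_nhdsWithin.1 (hlt2.and hlt3)
  refine ⟨V ∩ U, hV.inter hU, ⟨hξV, hξU⟩, fun A hA hAm => ?_⟩
  obtain ⟨h1, h2⟩ := hVb A (fun ζ hζ => ⟨(hA hζ).1, (hA hζ).2.1⟩) hAm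
  have hAJ : ∀ ζ ∈ A, J ξ < b * J ζ ∧ J ζ < b * J ξ := fun ζ hζ =>
    hUb ⟨(hA hζ).2.2, (hA hζ).1⟩
  have h3 : J ξ * Measure.pi (fun j => surfaceMeasure (S j)) A ≤
      b * ∫⁻ ζ in A, J ζ ∂(Measure.pi fun j => surfaceMeasure (S j)) := by
    rw [← setLIntegral_const, ← lintegral_const_mul' _ _ ENNReal.coe_ne_top]
    exact setLIntegral_mono' hAm fun ζ hζ => (hAJ ζ hζ).1.le
  have h4 : ∫⁻ ζ in A, J ζ ∂(Measure.pi fun j => surfaceMeasure (S j)) ≤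
      b * (J ξ * Measure.pi (fun j => surfaceMeasure (S j)) A) := by
    rw [← mul_assoc, ← setLIntegral_const]
    exact setLIntegral_mono' hAm fun ζ hζ => (hAJ ζ hζ).2.le
  have hbc3 : (b : ℝ≥0∞) ^ 3 ≤ c := by exact_mod_cast hbc
  have hbc2 : (b : ℝ≥0∞) * b ≤ c := by
    refine le_trans ?_ hbc3
    rw [pow_succ, pow_two]
    exact le_mul_of_one_le_right' hb1.le
  constructor
  · calc volume (subLast '' A) ≤ b * (J ξ * Measure.pi (fun j => surfaceMeasure (S j)) A) := h1
      _ ≤ b * (b * ∫⁻ ζ in A, J ζ ∂(Measure.pi fun j => surfaceMeasure (S j))) := by gcongr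
      _ ≤ c * ∫⁻ ζ in A, J ζ ∂(Measure.pi fun j => surfaceMeasure (S j)) := by
          rw [← mul_assoc]; gcongr
  · calc ∫⁻ ζ in A, J ζ ∂(Measure.pi fun j => surfaceMeasure (S j))
        ≤ b * (b ^ 2 * volume (subLast '' A)) := h4.trans (by gcongr)
      _ = b ^ 3 * volume (subLast '' A) := by ring
      _ ≤ c * volume (subLast '' A) := by gcongr

theorem aemeasurable_wedgeAbs_normal (hS : ∀ j, IsC1Hypersurface (S j))
    [∀ j, SigmaFinite (surfaceMeasure (S j))]
    (hv : ∀ j, ∀ ξ ∈ S j, IsUnitNormalAt (S j) ξ (v j ξ)) :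
    AEMeasurable (fun ζ : Fin (m + 1) → EuclideanSpace ℝ (Fin (m + 1)) =>
      ENNReal.ofReal (wedgeAbs fun j => v j (ζ j)))
      (Measure.pi fun j => surfaceMeasure (S j)) := by
  rw [← restrict_pi_surfaceMeasure hS]
  exact ((continuousOn_wedgeAbs_normal hS hv).aemeasurable
    (MeasurableSet.univ_pi fun j => (hS j).measurableSet)).ennreal_ofReal

/-- Global transversality says that the difference map is injective on the product of the
hypersurfaces. -/
theorem injOn_subLast
    (hGT : ∀ ξ η : Fin (m + 1) → EuclideanSpace ℝ (Fin (m + 1)),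
      (∀ j, ξ j ∈ S j) → (∀ j, η j ∈ S j) →
        ∀ a : EuclideanSpace ℝ (Fin (m + 1)), (∀ j, ξ j - η j = a) → a = 0) :
    InjOn subLast (univ.pi S) := by
  intro ξ hξ η hη h
  have hall : ∀ j, ξ j - η j = ξ (Fin.last m) - η (Fin.last m) := by
    refine Fin.lastCases rfl fun i => ?_
    have := congrFun h i
    simp only [subLast] at this
    rw [sub_eq_sub_iff_add_eq_add] at this ⊢
    exact this.trans (add_comm _ _)
  have h0 := hGT ξ η (fun j => hξ j trivial) (fun j => hη j trivial) _ hall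
  funext j
  exact sub_eq_zero.1 ((hall j).trans h0)

/-- The change of variables `w = subLast ξ`: the image of the measure
`|v₀ ∧ ⋯ ∧ v_m| dσ₀ ⋯ dσ_m` is Lebesgue measure on the image of the product of the
hypersurfaces. -/
theorem map_subLast_withDensity_wedgeAbs (hS : ∀ j, IsC1Hypersurface (S j))
    [∀ j, SigmaFinite (surfaceMeasure (S j))]
    (hv : ∀ j, ∀ ξ ∈ S j, IsUnitNormalAt (S j) ξ (v j ξ))
    (hT : ∀ ξ : Fin (m + 1) → EuclideanSpace ℝ (Fin (m + 1)), (∀ j, ξ j ∈ S j) →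
      wedgeAbs (fun j => v j (ξ j)) ≠ 0)
    (hinj : InjOn subLast (univ.pi S)) :
    ((Measure.pi fun j => surfaceMeasure (S j)).withDensity fun ζ =>
      ENNReal.ofReal (wedgeAbs fun j => v j (ζ j))).map subLast =
        volume.restrict (subLast '' univ.pi S) := by
  set J : (Fin (m + 1) → EuclideanSpace ℝ (Fin (m + 1))) → ℝ≥0∞ :=
    fun ζ => ENNReal.ofReal (wedgeAbs fun j => v j (ζ j)) with hJ
  set X : Set (Fin (m + 1) → EuclideanSpace ℝ (Fin (m + 1))) := univ.pi S with hX
  have hXm : MeasurableSet X := MeasurableSet.univ_pi fun j => (hS j).measurableSet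
  have hπX : MeasurableSet (subLast '' X) :=
    hXm.image_of_continuousOn_injOn continuous_subLast.continuousOn hinj
  obtain ⟨R, hRm, hR⟩ :=
    exists_measurable_leftInverse hXm continuous_subLast.continuousOn hinj
  -- the local estimates compare measures on the product, so Lebesgue measure is pulled back to it
  set μ := (volume.restrict (subLast '' X)).map R with hμ
  have hμA : ∀ A, MeasurableSet A → A ⊆ X → μ A = volume (subLast '' A) := fun A hA hAX => by
    rw [hμ, Measure.map_apply hRm hA, Measure.restrict_apply (hRm hA)]
    congr 1
    ext y
    constructor
    · rintro ⟨hy, ζ, hζ, rfl⟩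
      rw [mem_preimage, hR ζ hζ] at hy
      exact ⟨ζ, hy, rfl⟩
    · rintro ⟨ζ, hζ, rfl⟩
      exact ⟨by rw [mem_preimage, hR ζ (hAX hζ)]; exact hζ, ζ, hAX hζ, rfl⟩
  have hμX : μ Xᶜ = 0 := by
    rw [hμ, Measure.map_apply hRm hXm.compl, Measure.restrict_apply (hRm hXm.compl)]
    convert measure_empty (μ := (volume : Measure (Fin m → EuclideanSpace ℝ (Fin (m + 1)))))
    rw [eq_empty_iff_forall_notMem]
    rintro _ ⟨hy, ζ, hζ, rfl⟩
    rw [mem_preimage, hR ζ hζ] at hy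
    exact hy hζ
  have hνX : (Measure.pi fun j => surfaceMeasure (S j)).withDensity J Xᶜ = 0 := by
    refine withDensity_absolutelyContinuous _ _ ?_
    rw [← restrict_pi_surfaceMeasure hS, Measure.restrict_apply hXm.compl, compl_inter_self,
      measure_empty]
  have hμν : μ = (Measure.pi fun j => surfaceMeasure (S j)).withDensity J := by
    refine le_antisymm (Measure.le_of_forall_nhd_le_mul hXm hμX fun ξ hξ c hc => ?_)
      (Measure.le_of_forall_nhd_le_mul hXm hνX fun ξ hξ c hc => ?_) <;>
    obtain ⟨V, hV, hξV, hVA⟩ := exists_nhd_volume_image_subLast_le_lintegral hS hv hT hξ hc <;>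
    refine ⟨V, hV, hξV, fun A hA hAm => ?_⟩ <;>
    rw [hμA A hAm fun ζ hζ => (hA hζ).1, withDensity_apply _ hAm]
    · exact (hVA A hA hAm).1
    · exact (hVA A hA hAm).2
  rw [← hμν, hμ, Measure.map_map continuous_subLast.measurable hRm]
  conv_rhs => rw [← Measure.map_id (μ := volume.restrict (subLast '' X))]
  refine Measure.map_congr ?_
  filter_upwards [ae_restrict_mem hπX] with y hy
  obtain ⟨ζ, hζ, rfl⟩ := hy
  rw [Function.comp_apply, hR ζ hζ, id]

end ChangeOfVariables

/-! ### Convolutions of extensions -/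

section FourierExtension

variable {n : ℕ}

theorem norm_exp_neg_two_pi_I_mul (r : ℝ) :
    ‖Complex.exp (-2 * Real.pi * Complex.I * (r : ℝ))‖ = 1 := by
  have : (-2 * Real.pi * Complex.I * (r : ℝ) : ℂ) = ((-2 * Real.pi * r : ℝ) : ℂ) * Complex.I := by
    push_cast
    ring
  rw [this, Complex.norm_exp_ofReal_mul_I]

theorem enorm_exp_neg_two_pi_I_mul (r : ℝ) :
    ‖Complex.exp (-2 * Real.pi * Complex.I * (r : ℝ))‖ₑ = 1 := by
  rw [← ofReal_norm, norm_exp_neg_two_pi_I_mul, ENNReal.ofReal_one]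

theorem Complex.enorm_finsetProd {ι : Type*} (s : Finset ι) (f : ι → ℂ) :
    ‖∏ i ∈ s, f i‖ₑ = ∏ i ∈ s, ‖f i‖ₑ := by
  simp only [enorm_eq_nnnorm, nnnorm_prod]
  exact map_prod ENNReal.ofNNRealHom _ _

theorem integrable_mul_exp {σ : Measure (EuclideanSpace ℝ (Fin n))}
    {g : EuclideanSpace ℝ (Fin n) → ℂ} (hg : Integrable g σ) (x : EuclideanSpace ℝ (Fin n)) :
    Integrable (fun ξ => g ξ *
      Complex.exp (-2 * Real.pi * Complex.I * (inner ℝ x ξ : ℝ))) σ := by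
  refine hg.mul_bdd (c := 1) (Continuous.aestronglyMeasurable (by fun_prop)) ?_
  exact Filter.Eventually.of_forall fun ξ => (norm_exp_neg_two_pi_I_mul _).le

theorem continuous_fourierExtension {σ : Measure (EuclideanSpace ℝ (Fin n))}
    {g : EuclideanSpace ℝ (Fin n) → ℂ} (hg : Integrable g σ) :
    Continuous (fourierExtension σ g) := by
  refine continuous_of_dominated (bound := fun ξ => ‖g ξ‖)
    (fun x => (integrable_mul_exp hg x).1) (fun x => ?_) hg.norm ?_
  · refine Filter.Eventually.of_forall fun ξ => ?_
    rw [norm_mul, norm_exp_neg_two_pi_I_mul, mul_one]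
  · refine Filter.Eventually.of_forall fun ξ => ?_
    fun_prop

/-- The iterated convolution as one integral over all but the last variable. -/
theorem iteratedLConv_eq_lintegral_pi (k : ℕ) (f : Fin (k + 1) → EuclideanSpace ℝ (Fin n) → ℝ≥0∞)
    (hf : ∀ j, Measurable (f j)) (x : EuclideanSpace ℝ (Fin n)) :
    iteratedLConv k f x = ∫⁻ y : Fin k → EuclideanSpace ℝ (Fin n),
      (∏ i, f i.castSucc (y i)) * f (Fin.last k) (x - ∑ i, y i) := by
  induction k generalizing x with
  | zero =>
    rw [Measure.volume_pi_eq_dirac (fun i => i.elim0), lintegral_dirac]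
    simp [iteratedLConv]
  | succ k ih =>
    have hmeas : Measurable fun y : Fin (k + 1) → EuclideanSpace ℝ (Fin n) =>
        (∏ i, f i.castSucc (y i)) * f (Fin.last (k + 1)) (x - ∑ i, y i) := by
      refine Measurable.mul (Finset.measurable_prod _ fun i _ =>
        (hf _).comp (measurable_pi_apply i)) ((hf _).comp ?_)
      fun_prop
    have hmp := (volume_preserving_piFinSuccAbove
      (fun _ : Fin (k + 1) => EuclideanSpace ℝ (Fin n)) 0).symm
    rw [← hmp.lintegral_comp hmeas, Measure.volume_eq_prod,
      lintegral_prod _ (by exact (hmeas.comp hmp.measurable).aemeasurable)]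
    simp only [iteratedLConv, lconvolution]
    refine lintegral_congr fun a => ?_
    rw [ih _ fun j => hf j.succ, ← lintegral_const_mul]
    · refine lintegral_congr fun y => ?_
      simp only [MeasurableEquiv.piFinSuccAbove_symm_apply, Fin.insertNthEquiv_apply,
        Fin.insertNth_zero', Fin.prod_univ_succ, Fin.sum_univ_succ, Fin.cons_zero, Fin.cons_succ,
        Fin.castSucc_zero, Fin.succ_castSucc, Fin.succ_last, mul_assoc]
      congr 3
      abel
    · refine Measurable.mul (Finset.measurable_prod _ fun i _ =>
        (hf _).comp (measurable_pi_apply i)) ((hf _).comp ?_)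
      fun_prop

variable {m : ℕ}

/-- A product of extensions, evaluated at frequencies with sum `x`, is an integral over the product
of the hypersurfaces in which the free frequencies pair with the differences `subLast ξ`. -/
theorem prod_fourierExtension_eq_integral
    {σ : Fin (m + 1) → Measure (EuclideanSpace ℝ (Fin n))} [∀ j, SigmaFinite (σ j)]
    (g : Fin (m + 1) → EuclideanSpace ℝ (Fin n) → ℂ)
    (x : EuclideanSpace ℝ (Fin n)) (y : Fin m → EuclideanSpace ℝ (Fin n)) :
    (∏ i, fourierExtension (σ i.castSucc) (g i.castSucc) (y i)) *
        fourierExtension (σ (Fin.last m)) (g (Fin.last m)) (x - ∑ i, y i) =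
      ∫ ξ : Fin (m + 1) → EuclideanSpace ℝ (Fin n), ((∏ j, g j (ξ j)) *
        Complex.exp (-2 * Real.pi * Complex.I * (inner ℝ x (ξ (Fin.last m)) : ℝ))) *
        Complex.exp (-2 * Real.pi * Complex.I * (∑ i, inner ℝ (y i) (subLast ξ i) : ℝ))
        ∂(Measure.pi σ) := by
  set z : Fin (m + 1) → EuclideanSpace ℝ (Fin n) :=
    Fin.snoc (α := fun _ => EuclideanSpace ℝ (Fin n)) y (x - ∑ i, y i) with hz
  have h1 : (∏ i, fourierExtension (σ i.castSucc) (g i.castSucc) (y i)) *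
        fourierExtension (σ (Fin.last m)) (g (Fin.last m)) (x - ∑ i, y i) =
      ∏ j, fourierExtension (σ j) (g j) (z j) := by
    simp [Fin.prod_univ_castSucc, hz]
  rw [h1]
  refine (integral_fintype_prod_eq_prod (μ := σ) fun j ξ => g j ξ *
    Complex.exp (-2 * Real.pi * Complex.I * (inner ℝ (z j) ξ : ℝ))).symm.trans ?_
  refine integral_congr_ae (Filter.Eventually.of_forall fun ξ => ?_)
  simp only
  rw [Finset.prod_mul_distrib, ← Complex.exp_sum, mul_assoc (∏ j, g j (ξ j)), ← Complex.exp_add,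
    ← Finset.mul_sum, ← mul_add, ← Complex.ofReal_sum, ← Complex.ofReal_add]
  congr 4
  rw [Fin.sum_univ_castSucc]
  simp only [hz, Fin.snoc_castSucc, Fin.snoc_last, subLast, inner_sub_right, inner_sub_left,
    sum_inner, Finset.sum_sub_distrib]
  ring

end FourierExtension

section Density

open Set

/-- Transport of an integrable function `G` along a map `p` that is injective on `X` with Jacobian
`J` there: the function `H = (G / J) ∘ p⁻¹` represents `G` under `p`. -/
theorem exists_density_of_map_withDensity {Z W : Type*} [MeasurableSpace Z] [MeasureSpace W]
    {μ : Measure Z} {X : Set Z} {p : Z → W} {R : W → Z} (hp : Measurable p) (hR : Measurable R)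
    (hRp : ∀ ζ ∈ X, R (p ζ) = ζ) (hX : ∀ᵐ ζ ∂μ, ζ ∈ X) (hpX : MeasurableSet (p '' X))
    {J : Z → ℝ≥0∞} (hJ : AEMeasurable J μ) (hJ0 : ∀ ζ ∈ X, J ζ ≠ 0) (hJt : ∀ ζ, J ζ ≠ ⊤)
    (hmap : (μ.withDensity J).map p = volume.restrict (p '' X)) {G : Z → ℂ}
    (hG : Integrable G μ) :
    ∃ H : W → ℂ, Integrable H ∧
      (∀ φ : W → ℂ, Measurable φ → ∫ w, H w * φ w = ∫ ζ, G ζ * φ (p ζ) ∂μ) ∧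
      ∫⁻ w, ‖H w‖ₑ ^ 2 = ∫⁻ ζ, ‖G ζ‖ₑ ^ 2 / J ζ ∂μ := by
  -- `G` and `J` are only a.e. measurable, and `R` need not preserve null sets: the density is built
  -- from measurable representatives
  obtain ⟨G', hG'm, hGG'⟩ := hG.1.aemeasurable
  obtain ⟨J', hJ'm, hJJ'⟩ := hJ
  have hJ : AEMeasurable J μ := ⟨J', hJ'm, hJJ'⟩
  set h : W → ℂ := fun w => G' (R w) / ((J' (R w)).toReal : ℂ) with hh
  have hhm : Measurable h := (hG'm.comp hR).div
    (Complex.measurable_ofReal.comp (hJ'm.comp hR).ennreal_toReal)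
  have hhp : ∀ᵐ ζ ∂μ, h (p ζ) = G ζ / ((J ζ).toReal : ℂ) := by
    filter_upwards [hX, hGG', hJJ'] with ζ hζ h1 h2
    rw [hh]
    simp only [hRp ζ hζ, h1, h2]
  have hJpos : ∀ ζ ∈ X, 0 < (J ζ).toReal := fun ζ hζ => ENNReal.toReal_pos (hJ0 ζ hζ) (hJt ζ)
  have hnorm : ∀ᵐ ζ ∂μ, ‖h (p ζ)‖ₑ = ‖G ζ‖ₑ / J ζ := by
    filter_upwards [hX, hhp] with ζ hζ h1
    rw [h1, ← ofReal_norm, norm_div, Complex.norm_real, Real.norm_of_nonneg (hJpos ζ hζ).le,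
      ENNReal.ofReal_div_of_pos (hJpos ζ hζ), ofReal_norm, ENNReal.ofReal_toReal (hJt ζ)]
  -- the change of variables for nonnegative functions
  have hlint : ∀ F : W → ℝ≥0∞, Measurable F →
      ∫⁻ w in p '' X, F w = ∫⁻ ζ, J ζ * F (p ζ) ∂μ := fun F hF => by
    rw [← hmap, lintegral_map hF hp,
      lintegral_withDensity_eq_lintegral_mul₀ hJ (by exact (hF.comp hp).aemeasurable)]
    rfl
  refine ⟨(p '' X).indicator h, ⟨(hhm.indicator hpX).aestronglyMeasurable, ?_⟩,
    fun φ hφ => ?_, ?_⟩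
  · rw [hasFiniteIntegral_iff_enorm]
    simp only [enorm_indicator_eq_indicator_enorm]
    rw [lintegral_indicator hpX, hlint _ hhm.enorm]
    refine lt_of_le_of_lt (lintegral_mono_ae ?_) hG.2
    filter_upwards [hnorm] with ζ h1
    rw [h1]
    exact ENNReal.mul_div_le
  · have : ∀ w, (p '' X).indicator h w * φ w = (p '' X).indicator (fun w => h w * φ w) w :=
      fun w => (indicator_mul_left _ _ _).symm
    simp only [this]
    rw [integral_indicator hpX, ← hmap, integral_map hp.aemeasurable
      (by exact (hhm.mul hφ).aestronglyMeasurable), integral_withDensity_eq_integral_toReal_smul₀ hJ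
        (Filter.Eventually.of_forall fun ζ => (hJt ζ).lt_top)]
    refine integral_congr_ae ?_
    filter_upwards [hX, hhp] with ζ hζ h1
    have : ((J ζ).toReal : ℂ) ≠ 0 := Complex.ofReal_ne_zero.2 (hJpos ζ hζ).ne'
    simp only [h1, Complex.real_smul]
    field_simp
  · have : ∀ w, ‖(p '' X).indicator h w‖ₑ ^ 2 = (p '' X).indicator (fun w => ‖h w‖ₑ ^ 2) w :=
      fun w => by by_cases hw : w ∈ p '' X <;> simp [hw]
    simp only [this]
    rw [lintegral_indicator hpX, hlint _ (hhm.enorm.pow_const 2)]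
    refine lintegral_congr_ae ?_
    filter_upwards [hX, hnorm] with ζ hζ h1
    rw [h1, ENNReal.div_eq_inv_mul, mul_pow, pow_two (J ζ)⁻¹, mul_assoc, ← mul_assoc (J ζ),
      ENNReal.mul_inv_cancel (hJ0 ζ hζ) (hJt ζ), one_mul, ENNReal.div_eq_inv_mul]

end Density

theorem mainTheorem4 (m : ℕ)
    (S : Fin (m + 1) → Set (EuclideanSpace ℝ (Fin (m + 1))))
    (hS : ∀ j, IsC1Hypersurface (S j))
    (v : Fin (m + 1) → EuclideanSpace ℝ (Fin (m + 1)) → EuclideanSpace ℝ (Fin (m + 1)))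
    (hv : ∀ j, ∀ ξ ∈ S j, IsUnitNormalAt (S j) ξ (v j ξ))
    (hT : ∀ ξ : Fin (m + 1) → EuclideanSpace ℝ (Fin (m + 1)), (∀ j, ξ j ∈ S j) →
      wedgeAbs (fun j => v j (ξ j)) ≠ 0)
    (hGT : ∀ ξ η : Fin (m + 1) → EuclideanSpace ℝ (Fin (m + 1)),
      (∀ j, ξ j ∈ S j) → (∀ j, η j ∈ S j) →
        ∀ a : EuclideanSpace ℝ (Fin (m + 1)), (∀ j, ξ j - η j = a) → a = 0)
    (g : Fin (m + 1) → EuclideanSpace ℝ (Fin (m + 1)) → ℂ)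
    (hg : ∀ j, Integrable (g j) (surfaceMeasure (S j))) :
    ∀ x : EuclideanSpace ℝ (Fin (m + 1)),
      iteratedLConv m (fun j y => ‖fourierExtension (surfaceMeasure (S j)) (g j) y‖ₑ ^ 2) x =
        ∫⁻ ξ : Fin (m + 1) → EuclideanSpace ℝ (Fin (m + 1)),
          (∏ j, ‖g j (ξ j)‖ₑ ^ 2) / ENNReal.ofReal (wedgeAbs fun j => v j (ξ j))
          ∂(Measure.pi fun j => surfaceMeasure (S j)) := by
  intro x
  have hσ : ∀ j, SigmaFinite (surfaceMeasure (S j)) := fun j =>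
    (hS j).sigmaFinite_surfaceMeasure fun ξ hξ => ⟨v j ξ, hv j ξ hξ⟩
  have hinj := injOn_subLast hGT
  have hXm : MeasurableSet (Set.univ.pi S) := MeasurableSet.univ_pi fun j => (hS j).measurableSet
  have hπX : MeasurableSet (subLast '' Set.univ.pi S) :=
    hXm.image_of_continuousOn_injOn continuous_subLast.continuousOn hinj
  obtain ⟨R, hRm, hR⟩ :=
    exists_measurable_leftInverse hXm continuous_subLast.continuousOn hinj
  have hX : ∀ᵐ ξ ∂(Measure.pi fun j => surfaceMeasure (S j)), ξ ∈ Set.univ.pi S := by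
    rw [← restrict_pi_surfaceMeasure hS]
    exact ae_restrict_mem hXm
  set G : (Fin (m + 1) → EuclideanSpace ℝ (Fin (m + 1))) → ℂ := fun ξ => (∏ j, g j (ξ j)) *
    Complex.exp (-2 * Real.pi * Complex.I * (inner ℝ x (ξ (Fin.last m)) : ℝ)) with hG
  have hGi : Integrable G (Measure.pi fun j => surfaceMeasure (S j)) :=
    (Integrable.fintype_prod_dep hg).mul_bdd (c := 1)
      (Continuous.aestronglyMeasurable (by fun_prop))
      (Filter.Eventually.of_forall fun ξ => (norm_exp_neg_two_pi_I_mul _).le)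
  have hJ0 : ∀ ξ ∈ Set.univ.pi S, ENNReal.ofReal (wedgeAbs fun j => v j (ξ j)) ≠ 0 :=
    fun ξ hξ => by
      have : 0 < wedgeAbs fun j => v j (ξ j) :=
        lt_of_le_of_ne (abs_nonneg _) (Ne.symm (hT ξ fun j => hξ j trivial))
      simpa using this
  obtain ⟨H, hHi, hHφ, hH2⟩ := exists_density_of_map_withDensity continuous_subLast.measurable hRm
    hR hX hπX (aemeasurable_wedgeAbs_normal hS hv) hJ0 (fun ξ => ENNReal.ofReal_ne_top)
    (map_subLast_withDensity_wedgeAbs hS hv hT hinj) hGi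
  have hGn : ∀ ξ, ‖G ξ‖ₑ ^ 2 = ∏ j, ‖g j (ξ j)‖ₑ ^ 2 := fun ξ => by
    rw [hG, enorm_mul, enorm_exp_neg_two_pi_I_mul, mul_one, Finset.prod_pow,
      Complex.enorm_finsetProd]
  simp only [hGn] at hH2
  rw [← hH2, ← lintegral_enorm_sq_fourier_pi hHi, iteratedLConv_eq_lintegral_pi _ _
    fun j => (continuous_fourierExtension (hg j)).measurable.enorm.pow_const 2]
  refine lintegral_congr fun y => ?_
  rw [hHφ _ (Continuous.measurable (by fun_prop)), ← prod_fourierExtension_eq_integral g x y,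
    Finset.prod_pow, ← mul_pow, ← Complex.enorm_finsetProd, ← enorm_mul]
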